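/- For every sample size $n\ge 1$ and dimension $p\ge 1$ consider the following model (all objects may depend on $n$ and $p$). (i) $\mathcal T$ is a finite directed tree with vertex set $\mathcal V$ (an acyclic directed graph, connected when directions are ignored, in which every vertex has at most one parent $\mathrm{Pa}_v$). Its set $\mathcal Z$ of leaves (vertices without children) has $n$ elements, labelled $1,\dots,n$. (ii) For $v\in\mathcal V$, $(X_j(v))_{j\ge 1}$ is a sequence of real random variables and $\mathbf X(v)=(X_1(v),\dots,X_p(v))^\top$. For each $j=1,\dots,p$ the joint density (or mass function) of $(X_j(v))_{v\in\mathcal V}$ factorises along the tree, $p(x_j)=\prod_{v\in\mathcal V}p(x_j(v)\mid x_j(\mathrm{Pa}_v))$ (A1), and $\mathbb E[X_j(v)\mid X_j(\mathrm{Pa}_v)]=X_j(\mathrm{Pa}_v)$ for every $v$ other than the root (A2). Moreover $p^{-1}\mathbb E\|\mathbf X(v)\|^2=1$ for all $v\in\mathcal Z$. (iii) The data are $\mathbf Y_i=\gamma_i\mathbf X(i)$, $i=1,\dots,n$, where $\gamma_1,\dots,\gamma_n>0$ are random scalars, independent of the variables $X_j(v)$ and otherwise arbitrary. Write $\alpha(u,v)=p^{-1}\mathbb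 E\langle\mathbf X(u),\mathbf X(v)\rangle$ and $\hat\alpha_{\cos}(i,j)=\langle\mathbf Y_i,\mathbf Y_j\rangle/(\|\mathbf Y_i\|\,\|\mathbf Y_j\|)$ (read as $0$ if a denominator vanishes). Assume that there are a sequence $\varphi$ with $\sum_{k\ge1}\varphi^{1/2}(k)<\infty$, a real $q\ge 2$ and a finite constant $K$, none of them depending on $n$ or $p$, such that in each of the models: - for all $u,v\in\mathcal Z$ the sequence $\xi_j=(X_j(u),X_j(v))$, $j\ge1$, is $\varphi$-mixing with coefficients at most $\varphi$, i.e. for all $k\ge 1$ $$\sup_{j\ge1}\ \sup_{A\in\sigma(\xi_1,\dots,\xi_j),\ B\in\sigma(\xi_{j+k},\xi_{j+k+1},\dots),\ \mathbb P(A)>0}|\mathbb P(B\mid A)-\mathbb P(B)|\le\varphi(k);$$ - $\sup_{j\ge1}\max_{v\in\mathcal Z}\mathbb E|X_j(v)|^{2q}\le K$. Then $$\max_{i,j\in[n],\,i\ne j}|\alpha(i,j)-\hat\alpha_{\cos}(i,j)|\in O_{\mathbb P}\!\left(\frac{n^{2/q}}{\sqrt p}\right),$$ that is, for every $\epsilon>0$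 there is $\delta>0$ such that for all $n,p\ge1$ (the maximum over an empty set being $0$) $$\mathbb P\Big(\max_{i\ne j}|\alpha(i,j)-\hat\alpha_{\cos}(i,j)|>\delta\,n^{2/q}/\sqrt p\Big)<\epsilon .$$ -/

import Mathlib

open MeasureTheory ProbabilityTheory
open scoped ENNReal NNReal RealInnerProductSpace

universe u w

/-- A directed graph is a (rooted, directed) tree: it is acyclic, connected when the directions of
the edges are ignored, and every vertex has at most one parent. `T.Adj a b` is the edge `a → b`,
i.e. `a` is the parent of `b`. -/
structure Digraph.IsDirectedTree {V : Type u} (T : Digraph V) : Prop where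
  nonempty : Nonempty V
  acyclic : ∀ v, ¬ Relation.TransGen T.Adj v v
  connected : ∀ a b, Relation.EqvGen T.Adj a b
  parent_unique : ∀ a a' b, T.Adj a b → T.Adj a' b → a = a'

/-- A leaf is a vertex without children. -/
def Digraph.IsLeaf {V : Type u} (T : Digraph V) (v : V) : Prop := ∀ b, ¬ T.Adj v b

/-- `T` is the conditional independence graph of the family `(ξ v)`, `v ∈ V`, of real random
variables: with respect to some product of σ-finite reference measures `ν v` on `ℝ` (Lebesgue
measure for probability densities, counting measure on a countable set for mass functions) the
joint law has density `x ↦ ∏ v, f v (x_{Pa v}, x_v)`, where `f v (y, ·)` is a probability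
density with respect to `ν v` for each value `y` of the parent, so that `f v` is the conditional
density of `ξ v` given its parent. For the root the argument `y` ranges over a one-point space. -/
def Digraph.FactorisesAlong {V : Type u} [Fintype V] (T : Digraph V)
    {Ω : Type w} [MeasurableSpace Ω] (P : Measure Ω) (ξ : V → Ω → ℝ) : Prop :=
  ∃ ν : V → Measure ℝ, ∃ f : ∀ v : V, (({a : V // T.Adj a v} → ℝ) × ℝ) → ℝ≥0∞,
    (∀ v, SigmaFinite (ν v)) ∧
    (∀ v, Measurable (f v)) ∧
    (∀ v y, ∫⁻ x, f v (y, x) ∂(ν v) = 1) ∧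
    P.map (fun ω v => ξ v ω) =
      (Measure.pi ν).withDensity (fun x => ∏ v, f v (fun a => x a.1, x v))

/-- The martingale-like property `E[ξ v | ξ (Pa v)] = ξ (Pa v)` for every vertex `v` but
the root. -/
def Digraph.MartingaleAlong {V : Type u} (T : Digraph V)
    {Ω : Type w} [MeasurableSpace Ω] (P : Measure Ω) (ξ : V → Ω → ℝ) : Prop :=
  ∀ a v, T.Adj a v → Integrable (ξ v) P ∧
    P[ξ v | MeasurableSpace.comap (ξ a) inferInstance] =ᵐ[P] ξ a

/-- The `φ`-mixing coefficient at lag `k` of a sequence of random variables `ξ 0, ξ 1, …`: the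
supremum of `|P(B | A) - P(B)|` over `j`, over events `A` of positive probability in the
σ-algebra generated by `ξ i`, `i ≤ j`, and over `B` in the σ-algebra generated by `ξ i`,
`i ≥ j + k`. -/
noncomputable def phiMixingCoeff {Ω : Type w} [MeasurableSpace Ω] (P : Measure Ω)
    {E : Type*} [MeasurableSpace E] (ξ : ℕ → Ω → E) (k : ℕ) : ℝ :=
  sSup {r : ℝ | ∃ (j : ℕ) (A B : Set Ω),
    MeasurableSet[⨆ i : {i : ℕ // i ≤ j}, MeasurableSpace.comap (ξ i) inferInstance] A ∧
    MeasurableSet[⨆ i : {i : ℕ // j + k ≤ i}, MeasurableSpace.comap (ξ i) inferInstance] B ∧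
    0 < P A ∧ r = |(ProbabilityTheory.cond P A).real B - P.real B|}

/-- The vector `(ξ 0 ω, …, ξ (p - 1) ω)` as an element of Euclidean space. -/
noncomputable def firstCoords {Ω : Type w} (p : ℕ) (ξ : ℕ → Ω → ℝ) (ω : Ω) :
    EuclideanSpace ℝ (Fin p) :=
  WithLp.toLp 2 (fun j : Fin p => ξ j ω)

/-- The multiplicative noise model `Y i = γ i • X(i)` with `n` data vectors in dimension `p`. -/
structure MultiplicativeModel (n p : ℕ) where
  /-- the vertices of the tree -/
  V : Type u
  [fintypeV : Fintype V]
  /-- the tree -/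
  tree : Digraph V
  isDirectedTree : tree.IsDirectedTree
  /-- the leaves of the tree are labelled by `1, …, n` -/
  leaf : Fin n ≃ {v : V // tree.IsLeaf v}
  /-- the probability space -/
  Ω : Type w
  [measurableSpaceΩ : MeasurableSpace Ω]
  /-- the probability measure -/
  P : Measure Ω
  [isProbabilityMeasure : IsProbabilityMeasure P]
  /-- `X v j` is the `j`-th coordinate of the random vector at the vertex `v`; the
  coordinates form an infinite sequence, of which the first `p` are observed -/
  X : V → ℕ → Ω → ℝ
  measurable_X : ∀ v j, Measurable (X v j)
  /-- conditional independence along the tree, for each coordinate separately -/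
  factorises : ∀ j < p, tree.FactorisesAlong P (fun v => X v j)
  /-- the martingale-like property, for each coordinate separately -/
  martingale : ∀ j < p, tree.MartingaleAlong P (fun v => X v j)
  /-- `p⁻¹ E ‖X(v)‖² = 1` at every leaf -/
  normalised : ∀ v, tree.IsLeaf v → (p : ℝ)⁻¹ * ∫ ω, ‖firstCoords p (X v) ω‖ ^ 2 ∂P = 1
  /-- the multiplicative noise -/
  γ : Fin n → Ω → ℝ
  measurable_γ : ∀ i, Measurable (γ i)
  γ_pos : ∀ i, ∀ᵐ ω ∂P, 0 < γ i ω
  indep : IndepFun (fun ω i => γ i ω) (fun ω v j => X v j ω) P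

namespace MultiplicativeModel

attribute [instance] fintypeV measurableSpaceΩ isProbabilityMeasure

variable {n p : ℕ} (M : MultiplicativeModel.{u, w} n p)

/-- The random vector `X(v)` in `ℝᵖ`. -/
noncomputable def Xvec (v : M.V) : M.Ω → EuclideanSpace ℝ (Fin p) := firstCoords p (M.X v)

/-- The data vectors `Y i = γ i • X(i)`. -/
noncomputable def Y (i : Fin n) (ω : M.Ω) : EuclideanSpace ℝ (Fin p) :=
  M.γ i ω • M.Xvec (M.leaf i).1 ω

/-- The affinity `α(a, b) = p⁻¹ E⟨X(a), X(b)⟩`. -/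
noncomputable def affinity (a b : M.V) : ℝ := (p : ℝ)⁻¹ * ∫ ω, ⟪M.Xvec a ω, M.Xvec b ω⟫ ∂M.P

/-- The cosine similarity of `Y i` and `Y j` (equal to `0` if one of the two vectors is `0`). -/
noncomputable def cosSim (i j : Fin n) (ω : M.Ω) : ℝ :=
  ⟪M.Y i ω, M.Y j ω⟫ / (‖M.Y i ω‖ * ‖M.Y j ω‖)

/-- The maximal error `max_{i ≠ j} |α(i, j) - cos(Y i, Y j)|` (equal to `0` if `n = 1`). -/
noncomputable def maxError (ω : M.Ω) : ℝ :=
  ⨆ e : {e : Fin n × Fin n // e.1 ≠ e.2},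
    |M.affinity (M.leaf e.1.1).1 (M.leaf e.1.2).1 - M.cosSim e.1.1 e.1.2 ω|

end MultiplicativeModel

/-- `ξ i ∈ O_P(r i)` for a family of random variables `ξ i`, each on its own probability space:
the family `ξ i / r i` is bounded in probability, uniformly over all indices `i`. -/
def IsBigOInProbability {ι : Type*} {Ω : ι → Type w} [∀ i, MeasurableSpace (Ω i)]
    (P : ∀ i, Measure (Ω i)) (ξ : ∀ i, Ω i → ℝ) (r : ι → ℝ) : Prop :=
  ∀ ε : ℝ, 0 < ε → ∃ δ : ℝ, 0 < δ ∧ ∀ i, (P i).real {ω | δ * r i < |ξ i ω|} < ε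

/-! Positive factors cancel in a cosine, so almost surely the cosine similarity is that of the
unscaled vectors. A deterministic estimate (`abs_sub_inner_div_norm_mul_norm_le`) then reduces
everything to showing that the normalised inner products `p⁻¹⟪X(u), X(v)⟫` of all pairs of leaves,
including `u = v`, are within `t` of their means.

For one pair, the centred inner product is a sum `S` of `p` centred functions of a `φ`-mixing
sequence, with bounded `q`-th moments. The key claim is `E|S|^q ≤ (R√p)^q` with `R` independent of
the model. It is proved with the Doob martingale `E[S | past of n]`: mixing bounds the `L^q` norm of
the conditional mean of a summand `k` steps ahead by a multiple of `√φ(k)` plus a summable slack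
(`integral_abs_condExp_strictPast_rpow_le`), so summability of `√φ` bounds the martingale increments
in `L^q` uniformly. A Burkholder-type inequality (`exists_integral_abs_martingale_rpow_le`), derived
from a second-order Taylor bound for `|x|^q`, then gives the rate `√p`.

Markov's inequality at order `q` and a union bound over `n²` pairs produce the factor `n^(2/q)`. -/

/-! ### Elementary inequalities for real powers. -/

/-- Young's inequality in tangent-line form. -/
theorem Real.mul_rpow_sub_one_mul_le {q t z : ℝ} (hq : 1 ≤ q) (ht : 0 ≤ t) (hz : 0 ≤ z) :
    q * t ^ (q - 1) * z ≤ z ^ q + (q - 1) * t ^ q := by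
  have hq0 : 0 < q := by linarith
  have h := Real.geom_mean_le_arith_mean2_weighted (w₁ := (q - 1) / q) (w₂ := 1 / q)
    (div_nonneg (by linarith) hq0.le) (by positivity) (Real.rpow_nonneg ht q)
    (Real.rpow_nonneg hz q) (by field_simp; ring)
  rw [← Real.rpow_mul ht, ← Real.rpow_mul hz, mul_div_cancel₀ _ hq0.ne',
    mul_one_div_cancel hq0.ne', Real.rpow_one] at h
  have := mul_le_mul_of_nonneg_left h hq0.le
  have e : q * ((q - 1) / q * t ^ q + 1 / q * z ^ q) = z ^ q + (q - 1) * t ^ q := by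
    field_simp; ring
  linarith [mul_assoc q (t ^ (q - 1)) z]

theorem Real.abs_rpow_sub_two_mul_abs {q : ℝ} (hq : 1 < q) (x : ℝ) :
    |x| ^ (q - 2) * |x| = |x| ^ (q - 1) := by
  rcases eq_or_ne x 0 with rfl | hx
  · simp [Real.zero_rpow (by linarith : q - 1 ≠ 0)]
  · rw [← Real.rpow_add_one (abs_pos.2 hx).ne']; congr 1; ring

theorem Real.abs_rpow_sub_two_mul_sq {q : ℝ} (hq : 1 < q) (x : ℝ) :
    |x| ^ (q - 2) * x ^ 2 = |x| ^ q := by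
  rw [← sq_abs, sq, ← mul_assoc, Real.abs_rpow_sub_two_mul_abs hq]
  rcases eq_or_ne x 0 with rfl | hx
  · simp [Real.zero_rpow (by linarith : q ≠ 0)]
  · rw [← Real.rpow_add_one (abs_pos.2 hx).ne']; congr 1; ring

/-- The tangent line of the convex function `x ↦ |x| ^ q` at `y` lies below its graph. -/
theorem Real.abs_rpow_tangent_le {q : ℝ} (hq : 1 < q) (x y : ℝ) :
    |y| ^ q + q * (|y| ^ (q - 2) * y) * (x - y) ≤ |x| ^ q := by
  have h1 := Real.mul_rpow_sub_one_mul_le hq.le (abs_nonneg y) (abs_nonneg x)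
  have h2 : q * (|y| ^ (q - 2) * y) * y = q * |y| ^ q := by
    rw [← Real.abs_rpow_sub_two_mul_sq hq y]; ring
  have h3 : q * (|y| ^ (q - 2) * y) * x ≤ q * |y| ^ (q - 1) * |x| := by
    rw [← Real.abs_rpow_sub_two_mul_abs hq y]
    have : y * x ≤ |y| * |x| := by rw [← abs_mul]; exact le_abs_self _
    have hn : 0 ≤ q * |y| ^ (q - 2) := by positivity
    nlinarith [mul_le_mul_of_nonneg_left this hn]
  linarith

/-- A mean value estimate for `x ^ (q - 1)`, whose derivative is `(q - 1) x ^ (q - 2)`. Young's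
inequality with exponent `q - 1` replaces differentiation and puts the derivative at the larger
endpoint; `y ≤ 2 * a` brings it back to `a` at the cost of `2 ^ (q - 2)`. -/
theorem Real.abs_rpow_sub_two_mul_sub_le_of_pos {q a y : ℝ} (hq : 2 ≤ q) (ha : 0 < a)
    (hy : 0 < y) (hya : y ≤ 2 * a) :
    (|y| ^ (q - 2) * y - |a| ^ (q - 2) * a) * (y - a) ≤
      (q - 1) * 2 ^ (q - 2) * (|a| ^ (q - 2) * (y - a) ^ 2) := by
  have hp : ∀ z : ℝ, 0 < z → |z| ^ (q - 2) * z = z ^ (q - 1) := fun z hz => by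
    rw [abs_of_pos hz, ← Real.rpow_add_one hz.ne']; congr 1; ring
  have hp' : ∀ z : ℝ, 0 < z → z ^ (q - 2) * z = z ^ (q - 1) := fun z hz => by
    rw [← Real.rpow_add_one hz.ne']; congr 1; ring
  have e : q - 1 - 1 = q - 2 := by ring
  have h1 := Real.mul_rpow_sub_one_mul_le (q := q - 1) (by linarith) hy.le ha.le
  have h2 := Real.mul_rpow_sub_one_mul_le (q := q - 1) (by linarith) ha.le hy.le
  rw [e] at h1 h2
  rw [hp y hy, hp a ha, abs_of_pos ha]
  have h2q : 1 ≤ (2 : ℝ) ^ (q - 2) := Real.one_le_rpow (by norm_num) (by linarith)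
  have haq : 0 ≤ a ^ (q - 2) := by positivity
  rcases le_total a y with hay | hay
  · have hy2 : y ^ (q - 2) ≤ 2 ^ (q - 2) * a ^ (q - 2) := by
      rw [← Real.mul_rpow (by norm_num) ha.le]
      exact Real.rpow_le_rpow hy.le hya (by linarith)
    have h3 : y ^ (q - 1) - a ^ (q - 1) ≤ (q - 1) * y ^ (q - 2) * (y - a) := by
      have := hp' y hy
      nlinarith
    calc _ ≤ ((q - 1) * y ^ (q - 2) * (y - a)) * (y - a) :=
          mul_le_mul_of_nonneg_right h3 (by linarith)
      _ = (q - 1) * (y ^ (q - 2) * (y - a) ^ 2) := by ring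
      _ ≤ (q - 1) * ((2 ^ (q - 2) * a ^ (q - 2)) * (y - a) ^ 2) := by
          gcongr; linarith
      _ = _ := by ring
  · have h3 : a ^ (q - 1) - y ^ (q - 1) ≤ (q - 1) * a ^ (q - 2) * (a - y) := by
      have := hp' a ha
      nlinarith
    calc _ = (a ^ (q - 1) - y ^ (q - 1)) * (a - y) := by ring
      _ ≤ ((q - 1) * a ^ (q - 2) * (a - y)) * (a - y) :=
          mul_le_mul_of_nonneg_right h3 (by linarith)
      _ = (q - 1) * 1 * (a ^ (q - 2) * (y - a) ^ 2) := by ring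
      _ ≤ _ := by gcongr; linarith

/-- Second-order Taylor bound for `x ↦ |x| ^ q`, `q ≥ 2`. -/
theorem Real.exists_abs_add_rpow_le {q : ℝ} (hq : 2 ≤ q) :
    ∃ C : ℝ, 1 ≤ C ∧ ∀ a b : ℝ, |a + b| ^ q ≤
      |a| ^ q + q * (|a| ^ (q - 2) * a * b) + C * (|a| ^ (q - 2) * b ^ 2 + |b| ^ q) := by
  have hq1 : 1 < q := by linarith
  have h2q : 1 ≤ (2 : ℝ) ^ (q - 2) := Real.one_le_rpow (by norm_num) (by linarith)
  have h2q' : 1 ≤ (2 : ℝ) ^ (q - 1) := Real.one_le_rpow (by norm_num) (by linarith)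
  have h3q : 1 ≤ (3 : ℝ) ^ (q - 1) := Real.one_le_rpow (by norm_num) (by linarith)
  -- The first term serves `|b| < |a|`. For `|a| ≤ |b|` the second comes from `|a + b| ≤ 2|b|`, and
  -- the third need only be at least `1`.
  set C₁ := (q - 1) * 2 ^ (q - 2) + 2 ^ (q - 1) + 3 ^ (q - 1) with hC₁
  have hpos : 0 ≤ (q - 1) * 2 ^ (q - 2) := mul_nonneg (by linarith) (by linarith)
  refine ⟨q * C₁, by nlinarith, fun a b => ?_⟩
  -- With `ψ x = |x| ^ (q - 2) * x`, the tangent at `a + b` gives `|a + b|^q ≤ |a|^q + q ψ(a + b)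
  -- b`. Only the increment `ψ(a + b) - ψ(a)` remains to be bounded.
  have ht := Real.abs_rpow_tangent_le hq1 a (a + b)
  suffices h : (|a + b| ^ (q - 2) * (a + b) - |a| ^ (q - 2) * a) * b ≤
      C₁ * (|a| ^ (q - 2) * b ^ 2 + |b| ^ q) by
    have := mul_le_mul_of_nonneg_left h (by linarith : 0 ≤ q)
    nlinarith
  have hA : 0 ≤ |a| ^ (q - 2) * b ^ 2 := by positivity
  have hB : 0 ≤ |b| ^ q := by positivity
  rcases lt_or_ge |b| |a| with hlt | hge
  · have key : (|a + b| ^ (q - 2) * (a + b) - |a| ^ (q - 2) * a) * b ≤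
        (q - 1) * 2 ^ (q - 2) * (|a| ^ (q - 2) * b ^ 2) := by
      rcases lt_trichotomy a 0 with ha | ha | ha
      · rw [abs_of_neg ha] at hlt
        have hb := abs_lt.1 hlt
        have := Real.abs_rpow_sub_two_mul_sub_le_of_pos hq (a := -a) (y := -(a + b))
          (by linarith) (by linarith) (by linarith)
        rw [abs_neg, abs_neg] at this
        convert this using 1 <;> ring
      · subst ha; simp at hlt; exact absurd hlt (not_lt.2 (abs_nonneg b))
      · rw [abs_of_pos ha] at hlt
        have hb := abs_lt.1 hlt
        have := Real.abs_rpow_sub_two_mul_sub_le_of_pos hq (a := a) (y := a + b)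
          ha (by linarith) (by linarith)
        convert this using 1 <;> ring
    have : 0 ≤ (q - 1) * 2 ^ (q - 2) * |b| ^ q := mul_nonneg hpos hB
    rw [hC₁]; nlinarith
  · have hb1 : ∀ x c : ℝ, 0 ≤ c → |x| ≤ c * |b| →
        |(|x| ^ (q - 2) * x) * b| ≤ c ^ (q - 1) * |b| ^ q := fun x c hc hx => by
      rw [abs_mul, abs_mul, abs_of_nonneg (by positivity : 0 ≤ |x| ^ (q - 2)),
        Real.abs_rpow_sub_two_mul_abs hq1]
      calc |x| ^ (q - 1) * |b| ≤ (c * |b|) ^ (q - 1) * |b| := by gcongr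
        _ = c ^ (q - 1) * (|b| ^ (q - 2) * |b| * |b|) := by
          rw [Real.mul_rpow hc (abs_nonneg b), Real.abs_rpow_sub_two_mul_abs hq1]; ring
        _ = _ := by
          rw [mul_assoc (|b| ^ (q - 2)), ← sq, sq_abs, Real.abs_rpow_sub_two_mul_sq hq1]
    have i1 := le_of_abs_le (hb1 (a + b) 2 (by norm_num) (by linarith [abs_add_le a b]))
    have i2 := neg_le_of_abs_le (hb1 a 1 (by norm_num) (by linarith))
    rw [Real.one_rpow] at i2
    have : 0 ≤ (q - 1) * 2 ^ (q - 2) * |b| ^ q := mul_nonneg hpos hB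
    have j1 : 0 ≤ C₁ * (|a| ^ (q - 2) * b ^ 2) := mul_nonneg (by linarith) hA
    have j2 : 0 ≤ (3 ^ (q - 1) - 1) * |b| ^ q := mul_nonneg (by linarith) hB
    nlinarith

theorem Real.abs_add_rpow_le {q : ℝ} (hq : 1 ≤ q) (a b : ℝ) :
    |a + b| ^ q ≤ 2 ^ q * (|a| ^ q + |b| ^ q) := by
  have h : |a + b| ≤ 2 * max |a| |b| := by
    linarith [abs_add_le a b, le_max_left |a| |b|, le_max_right |a| |b|]
  calc |a + b| ^ q ≤ (2 * max |a| |b|) ^ q := by gcongr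
    _ = 2 ^ q * max |a| |b| ^ q := Real.mul_rpow (by norm_num) (by positivity)
    _ ≤ _ := by
      gcongr
      rcases max_cases |a| |b| with h | h <;> rw [h.1] <;>
        linarith [Real.rpow_nonneg (abs_nonneg a) q, Real.rpow_nonneg (abs_nonneg b) q]

/-- A weighted product of powers of total degree `q` is at most the sum of the `q`-th powers. -/
theorem Real.rpow_sub_mul_rpow_le {q s x y : ℝ} (hs : 0 ≤ s) (hsq : s ≤ q) (hx : 0 ≤ x)
    (hy : 0 ≤ y) : x ^ (q - s) * y ^ s ≤ x ^ q + y ^ q := by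
  have hm : 0 ≤ max x y := le_max_of_le_left hx
  calc x ^ (q - s) * y ^ s ≤ max x y ^ (q - s) * max x y ^ s := by
        gcongr <;> first | linarith | simp
    _ = max x y ^ q := by
        rw [← Real.rpow_add_of_nonneg hm (by linarith) hs, sub_add_cancel]
    _ ≤ _ := by
      rcases max_cases x y with h | h <;> rw [h.1] <;>
        linarith [Real.rpow_nonneg hx q, Real.rpow_nonneg hy q]

/-! ### Moments and `L^q` norms. -/

theorem MeasureTheory.MemLp.integrable_abs_rpow {Ω : Type*} [MeasurableSpace Ω] {P : Measure Ω}
    {q : ℝ} (hq : 0 < q) {f : Ω → ℝ} (hf : MemLp f (ENNReal.ofReal q) P) :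
    Integrable (fun ω => |f ω| ^ q) P := by
  have := hf.integrable_norm_rpow (by simpa using hq) ENNReal.ofReal_ne_top
  simpa [ENNReal.toReal_ofReal hq.le] using this

theorem MeasureTheory.memLp_of_integrable_abs_rpow {Ω : Type*} [MeasurableSpace Ω]
    {P : Measure Ω} {q : ℝ} (hq : 0 < q) {f : Ω → ℝ} (hf : AEStronglyMeasurable f P)
    (h : Integrable (fun ω => |f ω| ^ q) P) : MemLp f (ENNReal.ofReal q) P := by
  rw [← integrable_norm_rpow_iff hf (by simpa using hq) ENNReal.ofReal_ne_top]
  simpa [ENNReal.toReal_ofReal hq.le] using h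

theorem MeasureTheory.eLpNorm_le_ofReal_iff_integral_abs_rpow_le {Ω : Type*} [MeasurableSpace Ω]
    {P : Measure Ω} {q d : ℝ} (hq : 0 < q) (hd : 0 ≤ d) {f : Ω → ℝ}
    (hf : MemLp f (ENNReal.ofReal q) P) :
    eLpNorm f (ENNReal.ofReal q) P ≤ ENNReal.ofReal d ↔ ∫ ω, |f ω| ^ q ∂P ≤ d ^ q := by
  have h0 : 0 ≤ ∫ ω, |f ω| ^ q ∂P := integral_nonneg fun ω => by positivity
  rw [hf.eLpNorm_eq_integral_rpow_norm (by simpa using hq) ENNReal.ofReal_ne_top,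
    ENNReal.toReal_ofReal hq.le, ENNReal.ofReal_le_ofReal_iff hd]
  simp only [Real.norm_eq_abs]
  rw [Real.rpow_inv_le_iff_of_pos h0 hd hq]

/-- Hölder's inequality up to a factor `2`: after dividing `f` by `B` and `g` by `d`, integrate the
pointwise bound `x ^ (q - s) * y ^ s ≤ x ^ q + y ^ q`. -/
theorem MeasureTheory.integral_abs_rpow_mul_rpow_le {Ω : Type*} [MeasurableSpace Ω]
    {P : Measure Ω} {q s B d : ℝ} (hq : 0 < q) (hs : 0 ≤ s) (hsq : s ≤ q) (hB : 0 < B)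
    (hd : 0 < d) {f g : Ω → ℝ} (hf : MemLp f (ENNReal.ofReal q) P)
    (hg : MemLp g (ENNReal.ofReal q) P) (hfB : ∫ ω, |f ω| ^ q ∂P ≤ B ^ q)
    (hgd : ∫ ω, |g ω| ^ q ∂P ≤ d ^ q) :
    Integrable (fun ω => |f ω| ^ (q - s) * |g ω| ^ s) P ∧
      ∫ ω, |f ω| ^ (q - s) * |g ω| ^ s ∂P ≤ 2 * (B ^ (q - s) * d ^ s) := by
  have hif := hf.integrable_abs_rpow hq
  have hig := hg.integrable_abs_rpow hq
  have hpt : ∀ ω, |f ω| ^ (q - s) * |g ω| ^ s ≤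
      B ^ (q - s) * d ^ s * ((B ^ q)⁻¹ * |f ω| ^ q + (d ^ q)⁻¹ * |g ω| ^ q) := fun ω => by
    have h := Real.rpow_sub_mul_rpow_le hs hsq (div_nonneg (abs_nonneg (f ω)) hB.le)
      (div_nonneg (abs_nonneg (g ω)) hd.le)
    rw [Real.div_rpow (abs_nonneg _) hB.le, Real.div_rpow (abs_nonneg _) hd.le,
      Real.div_rpow (abs_nonneg _) hB.le, Real.div_rpow (abs_nonneg _) hd.le] at h
    have hBs : 0 < B ^ (q - s) := Real.rpow_pos_of_pos hB _
    have hds : 0 < d ^ s := Real.rpow_pos_of_pos hd _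
    have := mul_le_mul_of_nonneg_left h (mul_pos hBs hds).le
    calc _ = B ^ (q - s) * d ^ s * (|f ω| ^ (q - s) / B ^ (q - s) * (|g ω| ^ s / d ^ s)) := by
          field_simp
      _ ≤ _ := this
      _ = _ := by ring
  have hint : Integrable (fun ω => B ^ (q - s) * d ^ s *
      ((B ^ q)⁻¹ * |f ω| ^ q + (d ^ q)⁻¹ * |g ω| ^ q)) P :=
    ((hif.const_mul _).add (hig.const_mul _)).const_mul _
  have hfm := hf.1.aemeasurable
  have hgm := hg.1.aemeasurable
  have hI : Integrable (fun ω => |f ω| ^ (q - s) * |g ω| ^ s) P := by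
    refine hint.mono' (AEMeasurable.aestronglyMeasurable (by fun_prop)) (ae_of_all _ fun ω => ?_)
    rw [Real.norm_of_nonneg (by positivity)]
    exact hpt ω
  refine ⟨hI, (integral_mono hI hint hpt).trans ?_⟩
  rw [integral_const_mul, integral_add (hif.const_mul _) (hig.const_mul _), integral_const_mul,
    integral_const_mul, mul_comm (2 : ℝ)]
  have hBq : 0 < B ^ q := Real.rpow_pos_of_pos hB _
  have hdq : 0 < d ^ q := Real.rpow_pos_of_pos hd _
  have h1 : (B ^ q)⁻¹ * ∫ ω, |f ω| ^ q ∂P ≤ 1 := (inv_mul_le_one₀ hBq).2 hfB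
  have h2 : (d ^ q)⁻¹ * ∫ ω, |g ω| ^ q ∂P ≤ 1 := (inv_mul_le_one₀ hdq).2 hgd
  gcongr
  linarith

/-! ### Moments of martingales. -/

/-- Growth of the `q`-th moment when a martingale difference is added. -/
theorem MeasureTheory.integral_abs_add_rpow_le {q C : ℝ} (hq : 2 ≤ q) (hC0 : 0 ≤ C)
    (hC : ∀ a b : ℝ, |a + b| ^ q ≤
      |a| ^ q + q * (|a| ^ (q - 2) * a * b) + C * (|a| ^ (q - 2) * b ^ 2 + |b| ^ q))
    {Ω : Type*} {m mΩ : MeasurableSpace Ω} {P : Measure Ω} [IsProbabilityMeasure P]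
    (hm : m ≤ mΩ) {f g : Ω → ℝ} {B d : ℝ} (hB : 0 < B) (hd : 0 < d)
    (hfm : StronglyMeasurable[m] f) (hf : MemLp f (ENNReal.ofReal q) P)
    (hg : MemLp g (ENNReal.ofReal q) P) (hg0 : P[g | m] =ᵐ[P] 0)
    (hfB : ∫ ω, |f ω| ^ q ∂P ≤ B ^ q) (hgd : ∫ ω, |g ω| ^ q ∂P ≤ d ^ q) :
    ∫ ω, |f ω + g ω| ^ q ∂P ≤ B ^ q + C * (2 * (B ^ (q - 2) * d ^ (2 : ℝ)) + d ^ q) := by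
  have hq0 : 0 < q := by linarith
  have h1q : (1 : ℝ≥0∞) ≤ ENNReal.ofReal q := by
    rw [← ENNReal.ofReal_one]; exact ENNReal.ofReal_le_ofReal (by linarith)
  have hif := hf.integrable_abs_rpow hq0
  have hig := hg.integrable_abs_rpow hq0
  have hifg := (hf.add hg).integrable_abs_rpow hq0
  obtain ⟨hi2, hle2⟩ := integral_abs_rpow_mul_rpow_le hq0 (s := 2) (by norm_num) hq hB hd hf hg
    hfB hgd
  obtain ⟨hi1, -⟩ := integral_abs_rpow_mul_rpow_le hq0 (s := 1) (by norm_num) (by linarith)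
    hB hd hf hg hfB hgd
  have hfm' : StronglyMeasurable[m] (fun ω => |f ω| ^ (q - 2) * f ω) := by
    have := hfm.measurable
    exact Measurable.stronglyMeasurable (by fun_prop)
  have hprod : Integrable (fun ω => |f ω| ^ (q - 2) * f ω * g ω) P := by
    refine hi1.mono' ((hfm'.mono hm).aestronglyMeasurable.mul hg.1) (ae_of_all _ fun ω => ?_)
    rw [Real.norm_eq_abs, abs_mul, abs_mul, abs_of_nonneg (by positivity : 0 ≤ |f ω| ^ (q - 2)),
      Real.abs_rpow_sub_two_mul_abs (by linarith), Real.rpow_one]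
  -- The first-order Taylor term has mean zero: its factor in `f` is `m`-measurable and `g` has
  -- conditional mean zero.
  have hzero : ∫ ω, |f ω| ^ (q - 2) * f ω * g ω ∂P = 0 := by
    rw [← integral_condExp hm]
    have h := condExp_mul_of_stronglyMeasurable_left (m := m) (μ := P) hfm'
      (g := g) hprod (hg.integrable h1q)
    have h' : P[fun ω => |f ω| ^ (q - 2) * f ω * g ω | m] =ᵐ[P] 0 := by
      refine h.trans ?_
      filter_upwards [hg0] with ω hω
      simp [hω]
    rw [integral_congr_ae h']; simp
  simp only [Real.rpow_two, sq_abs] at hi2 hle2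
  have hR₁ : Integrable (fun ω => |f ω| ^ q + q * (|f ω| ^ (q - 2) * f ω * g ω)) P :=
    hif.add (hprod.const_mul q)
  have hR₂ : Integrable (fun ω => |f ω| ^ (q - 2) * g ω ^ 2 + |g ω| ^ q) P := hi2.add hig
  have hR : Integrable (fun ω => |f ω| ^ q + q * (|f ω| ^ (q - 2) * f ω * g ω) +
      C * (|f ω| ^ (q - 2) * g ω ^ 2 + |g ω| ^ q)) P := hR₁.add (hR₂.const_mul C)
  refine (integral_mono hifg hR fun ω => hC (f ω) (g ω)).trans ?_
  rw [integral_add hR₁ (hR₂.const_mul C),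
    integral_add hif (hprod.const_mul q), integral_const_mul, integral_const_mul,
    integral_add hi2 hig, hzero, mul_zero, add_zero, Real.rpow_two]
  gcongr

/-- A Burkholder-type inequality: the `q`-th moment of a martingale whose increments are bounded
in `L^q` grows at most like `n ^ (q / 2)`. -/
theorem MeasureTheory.exists_integral_abs_martingale_rpow_le {q : ℝ} (hq : 2 ≤ q) :
    ∃ A : ℝ, 1 ≤ A ∧ ∀ {Ω : Type w} {mΩ : MeasurableSpace Ω} (P : Measure Ω)
      [IsProbabilityMeasure P] (ℱ : Filtration ℕ mΩ) (f : ℕ → Ω → ℝ) (d : ℝ), 0 < d →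
      Martingale f ℱ P → f 0 =ᵐ[P] 0 →
      (∀ n, MemLp (f (n + 1) - f n) (ENNReal.ofReal q) P) →
      (∀ n, ∫ ω, |f (n + 1) ω - f n ω| ^ q ∂P ≤ d ^ q) →
      ∀ n, MemLp (f n) (ENNReal.ofReal q) P ∧
        ∫ ω, |f n ω| ^ q ∂P ≤ (A * d * √n) ^ q := by
  obtain ⟨C, hC1, hC⟩ := Real.exists_abs_add_rpow_le hq
  have hq0 : 0 < q := by linarith
  -- `A² = 3C` pays for the induction step, whose error is `2C` times the mixed term plus `C * d ^
  -- q`; the latter is absorbed because `(A√n) ^ (q - 2) ≥ 1`.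
  set A := √(3 * C) with hA
  have hA2 : A ^ (2 : ℝ) = 3 * C := by rw [Real.rpow_two, Real.sq_sqrt (by linarith)]
  have hA1 : 1 ≤ A := Real.one_le_sqrt.2 (by linarith)
  have hA0 : 0 < A := by linarith
  refine ⟨A, hA1, fun P _ ℱ f d hd hmart hf0 hmem hinc n => ?_⟩
  have hmemf : ∀ n, MemLp (f n) (ENNReal.ofReal q) P := fun n => by
    induction n with
    | zero => exact (memLp_congr_ae hf0).2 MemLp.zero
    | succ n ih => simpa using ih.add (hmem n)
  refine ⟨hmemf n, ?_⟩
  have hzero : ∫ ω, |f 0 ω| ^ q ∂P = 0 := by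
    rw [integral_congr_ae (g := fun _ => (0 : ℝ))]
    · simp
    · filter_upwards [hf0] with ω hω
      simp [hω, Real.zero_rpow hq0.ne']
  induction n with
  | zero => simp [hzero, Real.zero_rpow hq0.ne']
  | succ n ih =>
    -- The first increment is separate: the general step needs a positive bound `B` and `√n ≥ 1`.
    rcases Nat.eq_zero_or_pos n with rfl | hn
    · have : ∫ ω, |f 1 ω| ^ q ∂P = ∫ ω, |f 1 ω - f 0 ω| ^ q ∂P := by
        refine integral_congr_ae ?_
        filter_upwards [hf0] with ω hω
        simp [hω]
      simp only [zero_add, Nat.cast_one, Real.sqrt_one, mul_one]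
      rw [this]
      refine (hinc 0).trans ?_
      gcongr
      nlinarith
    · have hn0 : (0 : ℝ) < n := by exact_mod_cast hn
      have hn1 : (1 : ℝ) ≤ n := by exact_mod_cast hn
      have hs : 0 < √(n : ℝ) := Real.sqrt_pos.2 hn0
      have hg0 : P[f (n + 1) - f n | ℱ n] =ᵐ[P] 0 := by
        have h1 := condExp_sub (m := ℱ n) (hmart.integrable (n + 1)) (hmart.integrable n)
        filter_upwards [h1, hmart.2 n (n + 1) n.le_succ, hmart.2 n n le_rfl] with ω h1 h2 h3
        rw [h1, Pi.sub_apply, h2, h3, sub_self]; rfl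
      have h := integral_abs_add_rpow_le hq (by linarith) hC (ℱ.le n)
        (B := A * d * √n) (by positivity) hd (hmart.1 n) (hmemf n) (hmem n) hg0 ih (hinc n)
      simp only [Pi.sub_apply, add_sub_cancel] at h
      refine h.trans ?_
      have hr : ∀ c : ℝ, 0 < c → c ^ q = c ^ (q - 2) * c ^ (2 : ℝ) := fun c hc => by
        rw [← Real.rpow_add hc]; congr 1; ring
      have hsn : √(n : ℝ) ^ (2 : ℝ) = n := by rw [Real.rpow_two, Real.sq_sqrt hn0.le]
      have hsn1 : √((n + 1 : ℕ) : ℝ) ^ (2 : ℝ) = n + 1 := by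
        rw [Real.rpow_two, Real.sq_sqrt (by positivity)]; push_cast; ring
      have hs1 : 0 < √((n + 1 : ℕ) : ℝ) := Real.sqrt_pos.2 (by positivity)
      have hmono : √(n : ℝ) ^ (q - 2) ≤ √((n + 1 : ℕ) : ℝ) ^ (q - 2) :=
        Real.rpow_le_rpow hs.le (Real.sqrt_le_sqrt (by push_cast; linarith)) (by linarith)
      have hone : 1 ≤ √(n : ℝ) ^ (q - 2) :=
        Real.one_le_rpow (Real.one_le_sqrt.2 hn1) (by linarith)
      have hAone : 1 ≤ A ^ (q - 2) := Real.one_le_rpow hA1 (by linarith)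
      rw [Real.mul_rpow (by positivity) hs.le, Real.mul_rpow (by positivity) hs.le,
        Real.mul_rpow (by positivity) hs1.le, Real.mul_rpow hA0.le hd.le,
        Real.mul_rpow hA0.le hd.le, hr _ hs1, hr _ hs, hsn, hsn1, hr A hA0, hA2]
      set a := A ^ (q - 2)
      set s := √(n : ℝ) ^ (q - 2)
      set t := √((n + 1 : ℕ) : ℝ) ^ (q - 2)
      have hdq : d ^ (q - 2) * d ^ (2 : ℝ) = d ^ q := (hr d hd).symm
      have hdq0 : 0 < d ^ q := Real.rpow_pos_of_pos hd _
      have e : a * d ^ (q - 2) * s * d ^ (2 : ℝ) = a * s * d ^ q := by rw [← hdq]; ring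
      rw [e]
      have has : 1 ≤ a * s := by nlinarith
      calc _ = d ^ q * (3 * C * (a * s) * n + C * (2 * (a * s) + 1)) := by ring
        _ ≤ d ^ q * (3 * C * (a * s) * n + C * (2 * (a * s) + a * s)) := by gcongr
        _ = d ^ q * (3 * C * a * (n + 1)) * s := by ring
        _ ≤ d ^ q * (3 * C * a * (n + 1)) * t := by gcongr
        _ = _ := by ring

/-! ### Conditional means under near independence. -/

/-- By Young, `|Z|^q + (q - 1) t^q - q t^(q - 1) Z` is nonnegative, so its integral can only grow
from `ν` to `μ`. -/
theorem MeasureTheory.mul_integral_sub_integral_le_of_le {E : Type*} [MeasurableSpace E]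
    {μ ν : Measure E} [IsFiniteMeasure μ] (h : ν ≤ μ) {q t : ℝ} (hq : 1 ≤ q)
    (ht : 0 ≤ t) {Z : E → ℝ} (hZ : Integrable Z μ) (hZq : Integrable (fun x => |Z x| ^ q) μ) :
    q * t ^ (q - 1) * (∫ x, Z x ∂μ - ∫ x, Z x ∂ν) ≤
      (∫ x, |Z x| ^ q ∂μ - ∫ x, |Z x| ^ q ∂ν) +
        (q - 1) * t ^ q * (μ.real Set.univ - ν.real Set.univ) := by
  have : IsFiniteMeasure ν := isFiniteMeasure_of_le μ h
  have hint : ∀ κ : Measure E, IsFiniteMeasure κ → Integrable Z κ →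
      Integrable (fun x => |Z x| ^ q) κ →
      ∫ x, (|Z x| ^ q + (q - 1) * t ^ q - q * t ^ (q - 1) * Z x) ∂κ =
        ∫ x, |Z x| ^ q ∂κ + (q - 1) * t ^ q * κ.real Set.univ
          - q * t ^ (q - 1) * ∫ x, Z x ∂κ := fun κ _ h1 h2 => by
    have h3 : Integrable (fun x => |Z x| ^ q + (q - 1) * t ^ q) κ := h2.add (integrable_const _)
    rw [integral_sub h3 (h1.const_mul _),
      integral_add h2 (integrable_const _), integral_const, integral_const_mul, smul_eq_mul,
      mul_comm (κ.real _)]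
  have key := integral_mono_measure (f := fun x => |Z x| ^ q + (q - 1) * t ^ q -
      q * t ^ (q - 1) * Z x) h (ae_of_all _ fun x => ?_)
    ((hZq.add (integrable_const _)).sub (hZ.const_mul _))
  · rw [hint μ inferInstance hZ hZq,
      hint ν inferInstance (hZ.mono_measure h) (hZq.mono_measure h)] at key
    linarith
  · have h1 := Real.mul_rpow_sub_one_mul_le hq ht (abs_nonneg (Z x))
    have h2 : q * t ^ (q - 1) * Z x ≤ q * t ^ (q - 1) * |Z x| :=
      mul_le_mul_of_nonneg_left (le_abs_self _)
        (mul_nonneg (by linarith) (Real.rpow_nonneg ht _))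
    simp only [Pi.zero_apply]
    linarith

/-- Difference of the means of a function under two measures that are close in total
variation. -/
theorem MeasureTheory.mul_integral_sub_integral_le {E : Type*} [MeasurableSpace E]
    {μ ν : Measure E} [IsFiniteMeasure μ] [IsFiniteMeasure ν] {c : ℝ}
    (h : ∀ B, MeasurableSet B → |μ.real B - ν.real B| ≤ c) {q t : ℝ} (hq : 1 ≤ q)
    (ht : 0 ≤ t) {Z : E → ℝ} (hZμ : Integrable Z μ) (hZν : Integrable Z ν)
    (hZqμ : Integrable (fun x => |Z x| ^ q) μ) (hZqν : Integrable (fun x => |Z x| ^ q) ν) :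
    q * t ^ (q - 1) * (∫ x, Z x ∂μ - ∫ x, Z x ∂ν) ≤
      ∫ x, |Z x| ^ q ∂μ + ∫ x, |Z x| ^ q ∂ν + 2 * c * ((q - 1) * t ^ q) := by
  -- On `s` the measure `μ` dominates and on `sᶜ` the measure `ν` does. The ordered case applies to
  -- `Z` and to `-Z` respectively, each with excess mass at most `c`; hence `2 * c`.
  obtain ⟨s, hs, hs1, hs2⟩ := hahn_decomposition μ ν
  have hle1 : ν.restrict s ≤ μ.restrict s := Measure.le_iff.2 fun A hA => by
    rw [Measure.restrict_apply hA, Measure.restrict_apply hA]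
    exact hs1 _ (hA.inter hs) Set.inter_subset_right
  have hle2 : μ.restrict sᶜ ≤ ν.restrict sᶜ := Measure.le_iff.2 fun A hA => by
    rw [Measure.restrict_apply hA, Measure.restrict_apply hA]
    exact hs2 _ (hA.inter hs.compl) Set.inter_subset_right
  have k1 := mul_integral_sub_integral_le_of_le hle1 hq ht (Z := Z) hZμ.restrict hZqμ.restrict
  have k2 := mul_integral_sub_integral_le_of_le hle2 hq ht (Z := fun x => -Z x)
    hZν.neg.restrict (by simpa using hZqν.restrict)
  simp only [abs_neg, integral_neg, measureReal_restrict_apply_univ] at k1 k2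
  have c1 := le_of_abs_le (h s hs)
  have c2 := neg_le_of_abs_le (h sᶜ hs.compl)
  rw [← integral_add_compl hs hZμ, ← integral_add_compl hs hZν, ← integral_add_compl hs hZqμ,
    ← integral_add_compl hs hZqν]
  have n1 : 0 ≤ ∫ x in s, |Z x| ^ q ∂ν := integral_nonneg fun x => by positivity
  have n2 : 0 ≤ ∫ x in sᶜ, |Z x| ^ q ∂μ := integral_nonneg fun x => by positivity
  have hT : 0 ≤ (q - 1) * t ^ q := mul_nonneg (by linarith) (Real.rpow_nonneg ht _)
  have d1 := mul_le_mul_of_nonneg_left c1 hT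
  have d2 : (q - 1) * t ^ q * (ν.real sᶜ - μ.real sᶜ) ≤ (q - 1) * t ^ q * c :=
    mul_le_mul_of_nonneg_left (by linarith) hT
  linarith

theorem MeasureTheory.condExp_ae_le_of_forall_setIntegral_le {Ω : Type*}
    {m mΩ : MeasurableSpace Ω} {P : Measure Ω} [IsFiniteMeasure P] (hm : m ≤ mΩ) {f g : Ω → ℝ}
    (hf : Integrable f P) (hg : Integrable g P)
    (h : ∀ A, MeasurableSet[m] A → ∫ ω in A, f ω ∂P ≤ ∫ ω in A, g ω ∂P) :
    P[f | m] ≤ᵐ[P] P[g | m] := by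
  refine ae_le_of_ae_le_trim (hm := hm) ?_
  refine ae_le_of_forall_setIntegral_le (integrable_condExp.trim hm stronglyMeasurable_condExp)
    (integrable_condExp.trim hm stronglyMeasurable_condExp) fun A hA _ => ?_
  rw [← setIntegral_trim hm stronglyMeasurable_condExp hA,
    ← setIntegral_trim hm stronglyMeasurable_condExp hA, setIntegral_condExp hm hf hA,
    setIntegral_condExp hm hg hA]
  exact h A hA

/-- If `q tᵠ⁻¹ x - c (q - 1) tᵠ ≤ v` for all rational `t`, optimising over `t` bounds `x ^ q`. -/
theorem Real.rpow_le_of_forall_rat {q c x v : ℝ} (hq : 1 < q) (hc : 0 < c) (hx : 0 ≤ x)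
    (h : ∀ t : ℚ, q * |(t : ℝ)| ^ (q - 1) * x ≤ v + c * ((q - 1) * |(t : ℝ)| ^ q)) :
    x ^ q ≤ c ^ (q - 1) * v := by
  have hcont1 : Continuous fun t : ℝ => q * |t| ^ (q - 1) * x := by
    have := (continuous_abs (G := ℝ)).rpow_const (p := q - 1) fun _ => Or.inr (by linarith)
    fun_prop
  have hcont2 : Continuous fun t : ℝ => v + c * ((q - 1) * |t| ^ q) := by
    have := (continuous_abs (G := ℝ)).rpow_const (p := q) fun _ => Or.inr (by linarith)
    fun_prop
  have hall : ∀ t : ℝ, q * |t| ^ (q - 1) * x ≤ v + c * ((q - 1) * |t| ^ q) := fun t =>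
    Rat.denseRange_cast.induction_on
      (p := fun t : ℝ => q * |t| ^ (q - 1) * x ≤ v + c * ((q - 1) * |t| ^ q)) t
      (isClosed_le hcont1 hcont2) h
  -- The optimal `t`.
  have h1 := hall (x / c)
  rw [abs_of_nonneg (by positivity), Real.div_rpow hx hc.le, Real.div_rpow hx hc.le] at h1
  have hcq : c ^ q = c ^ (q - 1) * c := by
    rw [← Real.rpow_add_one hc.ne']; congr 1; ring
  have hxq : x ^ q = x ^ (q - 1) * x := by
    rcases eq_or_ne x 0 with rfl | hx0
    · simp [Real.zero_rpow (by linarith : q ≠ 0)]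
    · rw [← Real.rpow_add_one hx0]; congr 1; ring
  have hcp : 0 < c ^ (q - 1) := Real.rpow_pos_of_pos hc _
  have e1 : q * (x ^ (q - 1) / c ^ (q - 1)) * x = q * x ^ q / c ^ (q - 1) := by rw [hxq]; ring
  have e2 : c * ((q - 1) * (x ^ q / c ^ q)) = (q - 1) * x ^ q / c ^ (q - 1) := by
    rw [hcq]; field_simp
  rw [e1, e2] at h1
  have h2 : x ^ q / c ^ (q - 1) ≤ v := by
    have : q * x ^ q / c ^ (q - 1) = x ^ q / c ^ (q - 1) + (q - 1) * x ^ q / c ^ (q - 1) := by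
      ring
    linarith
  rw [div_le_iff₀ hcp] at h2
  linarith

/-- Conditional means of a centred variable that is nearly independent of `m` in the uniform
sense are small in `L^q`. -/
theorem MeasureTheory.integral_abs_condExp_rpow_le {Ω : Type*}
    {m mΩ : MeasurableSpace Ω} {P : Measure Ω} [IsProbabilityMeasure P] (hm : m ≤ mΩ) {q c : ℝ}
    (hq : 1 < q) (hc : 0 < c) {ζ : Ω → ℝ} (hζm : Measurable ζ)
    (hζ : MemLp ζ (ENNReal.ofReal q) P) (hζ0 : ∫ ω, ζ ω ∂P = 0)
    (h : ∀ A B, MeasurableSet[m] A → MeasurableSet B →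
      |P.real (A ∩ ζ ⁻¹' B) - P.real A * P.real (ζ ⁻¹' B)| ≤ c * P.real A) :
    ∫ ω, |P[ζ | m] ω| ^ q ∂P ≤ (2 * c) ^ (q - 1) * (2 * ∫ ω, |ζ ω| ^ q ∂P) := by
  have hq0 : 0 < q := by linarith
  have h1q : (1 : ℝ≥0∞) ≤ ENNReal.ofReal q := by
    rw [← ENNReal.ofReal_one]; exact ENNReal.ofReal_le_ofReal hq.le
  have hint : Integrable ζ P := hζ.integrable h1q
  have hintq := hζ.integrable_abs_rpow hq0
  set L := ∫ ω, |ζ ω| ^ q ∂P with hL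
  have hmem := (hζ.condExp (m := m) h1q).integrable_abs_rpow hq0
  -- The sign `σ` yields the absolute value. Rational `t` keeps the exceptional null sets countable
  -- in number, so that `t` can be optimised for each `ω`.
  have side : ∀ σ : ℝ, |σ| = 1 → ∀ t : ℚ, ∀ᵐ ω ∂P, q * |(t : ℝ)| ^ (q - 1) * (σ * P[ζ | m] ω) ≤
      P[fun ω => |ζ ω| ^ q | m] ω + L + 2 * c * ((q - 1) * |(t : ℝ)| ^ q) := by
    intro σ hσ t
    set a := q * |(t : ℝ)| ^ (q - 1) * σ
    set b := L + 2 * c * ((q - 1) * |(t : ℝ)| ^ q) with hb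
    have hle := condExp_ae_le_of_forall_setIntegral_le hm (f := fun ω => a * ζ ω)
      (g := fun ω => |ζ ω| ^ q + b) (hint.const_mul a) (hintq.add (integrable_const b))
      fun A hA => ?_
    · have e1 := condExp_smul (μ := P) a ζ m
      have e2 := condExp_add (m := m) hintq (integrable_const (μ := P) b)
      filter_upwards [hle, e1, e2] with ω h1 h2 h3
      rw [condExp_const hm b] at h3
      have h2' : P[fun ω => a * ζ ω | m] ω = a * P[ζ | m] ω := h2
      have h3' : P[fun ω => |ζ ω| ^ q + b | m] ω = P[fun ω => |ζ ω| ^ q | m] ω + b := h3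
      rw [h2', h3'] at h1
      calc _ = a * P[ζ | m] ω := by ring
        _ ≤ _ := h1
        _ = _ := by rw [hb]; ring
    · have hAm := hm A hA
      -- The hypothesis says that the law of `ζ` on `A` and `P(A)` times its law differ by at most
      -- `c * P(A)` on every Borel set; the mean of `ζ` under the second is `0`.
      let μ : Measure ℝ := (P.restrict A).map ζ
      let ν : Measure ℝ := (P A).toNNReal • P.map ζ
      have hPA : ((P A).toNNReal : ℝ) = P.real A := rfl
      have hμν : ∀ B, MeasurableSet B → |μ.real B - ν.real B| ≤ c * P.real A := fun B hB => by
        have e1 : μ.real B = P.real (A ∩ ζ ⁻¹' B) := by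
          rw [map_measureReal_apply hζm hB, measureReal_restrict_apply (hζm hB), Set.inter_comm]
        have e2 : ν.real B = P.real A * P.real (ζ ⁻¹' B) := by
          rw [measureReal_nnreal_smul_apply, map_measureReal_apply hζm hB, hPA]
        rw [e1, e2]
        exact h A B hA hB
      have hf1 : Measurable fun x : ℝ => σ * x := by fun_prop
      have hf2 : Measurable fun x : ℝ => |σ * x| ^ q := by fun_prop
      have j1 : Integrable (fun ω => σ * ζ ω) P := hint.const_mul σ
      have j2 : Integrable (fun ω => |σ * ζ ω| ^ q) P := by simpa [abs_mul, hσ] using hintq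
      have i1 : Integrable (fun x : ℝ => σ * x) μ :=
        (integrable_map_measure hf1.aestronglyMeasurable hζm.aemeasurable).2 j1.restrict
      have i2 : Integrable (fun x : ℝ => σ * x) ν :=
        ((integrable_map_measure hf1.aestronglyMeasurable hζm.aemeasurable).2 j1).smul_measure_nnreal
      have i3 : Integrable (fun x : ℝ => |σ * x| ^ q) μ :=
        (integrable_map_measure hf2.aestronglyMeasurable hζm.aemeasurable).2 j2.restrict
      have i4 : Integrable (fun x : ℝ => |σ * x| ^ q) ν :=
        ((integrable_map_measure hf2.aestronglyMeasurable hζm.aemeasurable).2 j2).smul_measure_nnreal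
      have key := mul_integral_sub_integral_le hμν hq.le (abs_nonneg (t : ℝ)) i1 i2 i3 i4
      simp only [abs_mul, hσ, one_mul, μ, ν, integral_smul_nnreal_measure] at key
      rw [integral_map hζm.aemeasurable (by fun_prop), integral_map hζm.aemeasurable (by fun_prop),
        integral_map hζm.aemeasurable (AEMeasurable.aestronglyMeasurable (by fun_prop)),
        integral_map hζm.aemeasurable (AEMeasurable.aestronglyMeasurable (by fun_prop)),
        integral_const_mul, integral_const_mul, hζ0, mul_zero, smul_zero, sub_zero] at key
      rw [integral_const_mul, integral_add hintq.restrict (integrable_const b), integral_const,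
        measureReal_restrict_apply_univ, smul_eq_mul, hb]
      have hsm : (P A).toNNReal • L = P.real A * L := rfl
      rw [← hL, hsm] at key
      calc _ = q * |(t : ℝ)| ^ (q - 1) * (σ * ∫ ω in A, ζ ω ∂P) := by ring
        _ ≤ _ := key
        _ = _ := by ring
  have hpt : ∀ᵐ ω ∂P, |P[ζ | m] ω| ^ q ≤
      (2 * c) ^ (q - 1) * (P[fun ω => |ζ ω| ^ q | m] ω + L) := by
    have s1 := ae_all_iff.2 (side 1 (by simp))
    have s2 := ae_all_iff.2 (side (-1) (by simp))
    filter_upwards [s1, s2] with ω h1 h2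
    refine Real.rpow_le_of_forall_rat hq (by positivity) (abs_nonneg _) fun t => ?_
    rcases abs_cases (P[ζ | m] ω) with h | h <;> rw [h.1]
    · simpa using h1 t
    · simpa using h2 t
  refine (integral_mono_ae hmem ((integrable_condExp.add (integrable_const L)).const_mul _)
    hpt).trans (le_of_eq ?_)
  rw [integral_const_mul]
  congr 1
  change ∫ ω, (P[fun ω => |ζ ω| ^ q | m] ω + L) ∂P = _
  rw [integral_add integrable_condExp (integrable_const L), integral_condExp hm]
  simp [hL]; ring

/-! ### Mixing coefficients and conditioning on the past. -/

theorem phiMixingCoeff_nonneg {Ω : Type*} [MeasurableSpace Ω] {P : Measure Ω} {E : Type*}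
    [MeasurableSpace E] {ξ : ℕ → Ω → E} (k : ℕ) : 0 ≤ phiMixingCoeff P ξ k := by
  refine Real.sSup_nonneg ?_
  rintro r ⟨j, A, B, -, -, -, rfl⟩
  exact abs_nonneg _

section PhiMixing

variable {Ω : Type*} [mΩ : MeasurableSpace Ω] {P : Measure Ω} [IsProbabilityMeasure P]
  {E : Type*} [MeasurableSpace E] {ξ : ℕ → Ω → E}

theorem abs_cond_real_sub_real_le_one (A B : Set Ω) :
    |(ProbabilityTheory.cond P A).real B - P.real B| ≤ 1 := by
  rw [abs_le]
  have h1 : (ProbabilityTheory.cond P A).real B ≤ 1 := measureReal_le_one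
  have h2 : P.real B ≤ 1 := measureReal_le_one
  have h3 : 0 ≤ (ProbabilityTheory.cond P A).real B := measureReal_nonneg
  have h4 : 0 ≤ P.real B := measureReal_nonneg
  constructor <;> linarith

theorem phiMixingCoeff_le_one (k : ℕ) : phiMixingCoeff P ξ k ≤ 1 := by
  refine Real.sSup_le ?_ zero_le_one
  rintro r ⟨j, A, B, -, -, -, rfl⟩
  exact abs_cond_real_sub_real_le_one A B

/-- Multiplying by `P(A)` makes the mixing bound valid for null `A` too. The set in the supremum is
bounded by `1`, so the supremum is a genuine upper bound. -/
theorem abs_real_inter_sub_mul_le_phiMixingCoeff (hξ : ∀ i, Measurable (ξ i)) (j k : ℕ)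
    {A B : Set Ω}
    (hA : MeasurableSet[⨆ i : {i : ℕ // i ≤ j}, MeasurableSpace.comap (ξ i) inferInstance] A)
    (hB : MeasurableSet[⨆ i : {i : ℕ // j + k ≤ i}, MeasurableSpace.comap (ξ i) inferInstance] B) :
    |P.real (A ∩ B) - P.real A * P.real B| ≤ phiMixingCoeff P ξ k * P.real A := by
  have hAm : MeasurableSet A :=
    iSup_le (fun i : {i : ℕ // i ≤ j} => (hξ i).comap_le) A hA
  rcases eq_or_ne (P A) 0 with h0 | h0
  · have h1 : P.real A = 0 := by simp [measureReal_def, h0]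
    have h2 : P.real (A ∩ B) = 0 := by
      simp [measureReal_def, measure_mono_null Set.inter_subset_left h0]
    simp [h1, h2]
  · have hle : |(ProbabilityTheory.cond P A).real B - P.real B| ≤ phiMixingCoeff P ξ k := by
      refine le_csSup ⟨1, ?_⟩ ⟨j, A, B, hA, hB, pos_iff_ne_zero.2 h0, rfl⟩
      rintro r ⟨j, A, B, -, -, -, rfl⟩
      exact abs_cond_real_sub_real_le_one A B
    have hpos : 0 < P.real A := ENNReal.toReal_pos h0 (measure_ne_top P A)
    have hc : (ProbabilityTheory.cond P A).real B = (P.real A)⁻¹ * P.real (A ∩ B) :=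
      by
      simp [measureReal_def, cond_apply hAm]
    rw [hc] at hle
    calc |P.real (A ∩ B) - P.real A * P.real B|
        = |(P.real A)⁻¹ * P.real (A ∩ B) - P.real B| * P.real A := by
          rw [← abs_of_pos hpos, ← abs_mul, abs_of_pos hpos]
          congr 1; field_simp
      _ ≤ _ := mul_le_mul_of_nonneg_right hle hpos.le

/-- The filtration of the strict past of a sequence of random variables. -/
def strictPast (ξ : ℕ → Ω → E) (hξ : ∀ i, Measurable (ξ i)) : Filtration ℕ mΩ where
  -- Strictness makes stage `0` trivial, so conditioning there returns the mean.
  seq n := ⨆ i : {i : ℕ // i < n}, MeasurableSpace.comap (ξ i) inferInstance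
  mono' _ b hab := iSup_le fun i =>
    le_iSup (fun i : {i : ℕ // i < b} => MeasurableSpace.comap (ξ i) inferInstance)
      ⟨i.1, i.2.trans_le hab⟩
  le' _ := iSup_le fun i => (hξ i).comap_le

theorem strictPast_zero (hξ : ∀ i, Measurable (ξ i)) : strictPast ξ hξ 0 = ⊥ :=
  iSup_eq_bot.2 fun i => absurd i.2 (Nat.not_lt_zero _)

theorem comap_le_strictPast (hξ : ∀ i, Measurable (ξ i)) {i n : ℕ} (h : i < n) :
    MeasurableSpace.comap (ξ i) inferInstance ≤ strictPast ξ hξ n :=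
  le_iSup (fun i : {i : ℕ // i < n} => MeasurableSpace.comap (ξ i) inferInstance) ⟨i, h⟩

/-- This is where `√φ` arises. Near independence gives the power `c ^ (q - 1)`, and `c ^ (q - 1) ≤ c
^ (q / 2) ≤ b ^ q` since `q ≥ 2` and `c ≤ 1`. The past of `n` ends at index `n - 1`, so `n + k - 1`
is at lag `k`. -/
theorem integral_abs_condExp_strictPast_rpow_le (hξ : ∀ i, Measurable (ξ i)) {q L b : ℝ}
    (hq : 2 ≤ q) (hL : 1 ≤ L) {n k : ℕ} (hk : 1 ≤ k) (hb : 0 < b)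
    (hφ : phiMixingCoeff P ξ k < b ^ 2) {ζ : Ω → ℝ}
    (hζm : Measurable[MeasurableSpace.comap (ξ (n + k - 1)) inferInstance] ζ)
    (hζ : MemLp ζ (ENNReal.ofReal q) P) (hζ0 : ∫ ω, ζ ω ∂P = 0)
    (hζL : ∫ ω, |ζ ω| ^ q ∂P ≤ L) :
    ∫ ω, |P[ζ | strictPast ξ hξ n] ω| ^ q ∂P ≤ (2 * L * b) ^ q := by
  have hq0 : 0 < q := by linarith
  rcases n with _ | j
  · rw [strictPast_zero, condExp_bot, hζ0]
    simp only [abs_zero, Real.zero_rpow hq0.ne', integral_zero]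
    positivity
  · set c := min (b ^ 2) 1 with hc
    have hc0 : 0 < c := lt_min (by positivity) one_pos
    have hc1 : c ≤ 1 := min_le_right _ _
    have hφc : phiMixingCoeff P ξ k ≤ c := le_min hφ.le (phiMixingCoeff_le_one k)
    have hjk : j + 1 + k - 1 = j + k := by omega
    rw [hjk] at hζm
    have h := integral_abs_condExp_rpow_le ((strictPast ξ hξ).le (j + 1)) (q := q) (c := c)
      (by linarith) hc0 (hζm.mono (hξ _).comap_le le_rfl) hζ hζ0 fun A B hA hB => ?_
    · refine h.trans ?_
      have h2q : (2 * c) ^ (q - 1) * (2 * ∫ ω, |ζ ω| ^ q ∂P) ≤ 2 ^ q * c ^ (q - 1) * L := by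
        have e : (2 : ℝ) ^ q = 2 ^ (q - 1) * 2 := by
          rw [← Real.rpow_add_one two_ne_zero]; congr 1; ring
        rw [Real.mul_rpow (by norm_num) hc0.le, e]
        calc _ ≤ 2 ^ (q - 1) * c ^ (q - 1) * (2 * L) := by gcongr
          _ = _ := by ring
      have hcb : c ^ (q - 1) ≤ b ^ q := by
        calc c ^ (q - 1) ≤ c ^ (q / 2) :=
              Real.rpow_le_rpow_of_exponent_ge hc0 hc1 (by linarith)
          _ ≤ (b ^ 2) ^ (q / 2) := Real.rpow_le_rpow hc0.le (min_le_left _ _) (by linarith)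
          _ = b ^ q := by
            rw [← Real.rpow_natCast, ← Real.rpow_mul hb.le]; congr 1; push_cast; ring
      have hLq : L ≤ L ^ q := Real.self_le_rpow_of_one_le hL (by linarith)
      rw [Real.mul_rpow (by positivity) hb.le, Real.mul_rpow (x := 2) (y := L) (by norm_num) (by linarith)]
      calc _ ≤ 2 ^ q * c ^ (q - 1) * L := h2q
        _ ≤ 2 ^ q * b ^ q * L ^ q := by gcongr
        _ = _ := by ring
    · refine (abs_real_inter_sub_mul_le_phiMixingCoeff hξ j k (A := A) ?_ ?_).trans
        (mul_le_mul_of_nonneg_right hφc measureReal_nonneg)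
      · have hle : strictPast ξ hξ (j + 1) ≤
            ⨆ i : {i : ℕ // i ≤ j}, MeasurableSpace.comap (ξ i) inferInstance :=
          iSup_le fun i => le_iSup
            (fun i : {i : ℕ // i ≤ j} => MeasurableSpace.comap (ξ i) inferInstance)
            ⟨i.1, Nat.lt_succ_iff.1 i.2⟩
        exact hle A hA
      · exact le_iSup (fun i : {i : ℕ // j + k ≤ i} =>
          MeasurableSpace.comap (ξ i) inferInstance) ⟨j + k, le_rfl⟩ _ (hζm hB)

end PhiMixing

/-! ### Moments of partial sums of mixing sequences. -/

theorem Summable.sum_comp_le_tsum_of_injOn {b : ℕ → ℝ} (hb : Summable b) (hb0 : ∀ k, 0 ≤ b k)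
    {s : Finset ℕ} {g : ℕ → ℕ} (hg : Set.InjOn g s) : ∑ i ∈ s, b (g i) ≤ ∑' k, b k := by
  rw [← Finset.sum_image (f := b) hg]
  exact hb.sum_le_tsum _ fun k _ => hb0 k

/-- If the conditional means of the variables given the past decay summably in `L^q`, the
partial sums have `q`-th moments of order `p ^ (q / 2)`. -/
theorem MeasureTheory.exists_integral_abs_sum_rpow_le_of_condExp {q : ℝ} (hq : 2 ≤ q)
    {b : ℕ → ℝ} (hb : Summable b) (hb0 : ∀ k, 0 < b k) :
    ∃ R : ℝ, 0 < R ∧ ∀ {Ω : Type w} {mΩ : MeasurableSpace Ω} (P : Measure Ω)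
      [IsProbabilityMeasure P] (ℱ : Filtration ℕ mΩ) (ζ : ℕ → Ω → ℝ), ℱ 0 = ⊥ →
      (∀ i, StronglyMeasurable[ℱ (i + 1)] (ζ i)) → (∀ i, MemLp (ζ i) (ENNReal.ofReal q) P) →
      (∀ i, ∫ ω, ζ i ω ∂P = 0) →
      (∀ n k, ∫ ω, |P[ζ (n + k - 1) | ℱ n] ω| ^ q ∂P ≤ b k ^ q) →
      ∀ p : ℕ, ∫ ω, |∑ i ∈ Finset.range p, ζ i ω| ^ q ∂P ≤ (R * √p) ^ q := by
  obtain ⟨A, hA1, hA⟩ := exists_integral_abs_martingale_rpow_le.{w} hq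
  have hq0 : 0 < q := by linarith
  have h1q : (1 : ℝ≥0∞) ≤ ENNReal.ofReal q := by
    rw [← ENNReal.ofReal_one]; exact ENNReal.ofReal_le_ofReal (by linarith)
  set T := ∑' k, b k with hT
  have hTpos : 0 < T := hb.tsum_pos (fun k => (hb0 k).le) 0 (hb0 0)
  refine ⟨A * (2 * T), by positivity, fun {Ω} {mΩ} P _ ℱ ζ hℱ0 hζm hζ hζ0 hcond p => ?_⟩
  set S : Ω → ℝ := ∑ i ∈ Finset.range p, ζ i with hS
  have hSmem : MemLp S (ENNReal.ofReal q) P := memLp_finsetSum' _ fun i _ => hζ i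
  have hSint : Integrable S P := hSmem.integrable h1q
  have hcmem : ∀ n, MemLp (P[S | ℱ n]) (ENNReal.ofReal q) P := fun n => hSmem.condExp h1q
  have hζcmem : ∀ i n, MemLp (P[ζ i | ℱ n]) (ENNReal.ofReal q) P := fun i n =>
    (hζ i).condExp h1q
  have hζnorm : ∀ i n k, i + 1 = n + k →
      eLpNorm (P[ζ i | ℱ n]) (ENNReal.ofReal q) P ≤ ENNReal.ofReal (b k) := fun i n k hk => by
    rw [eLpNorm_le_ofReal_iff_integral_abs_rpow_le hq0 (hb0 k).le (hζcmem i n)]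
    have : n + k - 1 = i := by omega
    simpa only [this] using hcond n k
  -- In the Doob increment at `n`, summands with `i < n` are already known and cancel. One with `i ≥
  -- n` contributes at most `b (i - n) + b (i + 1 - n)`, and each of the two families sums to at
  -- most `T`.
  have hinc : ∀ n, ∫ ω, |P[S | ℱ (n + 1)] ω - P[S | ℱ n] ω| ^ q ∂P ≤ (2 * T) ^ q := fun n => by
    refine (eLpNorm_le_ofReal_iff_integral_abs_rpow_le hq0 (by positivity)
      ((hcmem (n + 1)).sub (hcmem n))).1 ?_
    have hae : P[S | ℱ (n + 1)] - P[S | ℱ n] =ᵐ[P]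
        ∑ i ∈ Finset.range p, (P[ζ i | ℱ (n + 1)] - P[ζ i | ℱ n]) := by
      rw [Finset.sum_sub_distrib]
      exact (condExp_finsetSum (fun i _ => (hζ i).integrable h1q) _).sub
        (condExp_finsetSum (fun i _ => (hζ i).integrable h1q) _)
    rw [eLpNorm_congr_ae hae]
    refine (eLpNorm_sum_le (fun i _ => ((hζcmem i (n + 1)).sub (hζcmem i n)).1) h1q).trans ?_
    have hterm : ∀ i, eLpNorm (P[ζ i | ℱ (n + 1)] - P[ζ i | ℱ n]) (ENNReal.ofReal q) P ≤
        ENNReal.ofReal (if n ≤ i then b (i - n) + b (i + 1 - n) else 0) := fun i => by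
      split_ifs with hni
      · rw [ENNReal.ofReal_add (hb0 _).le (hb0 _).le]
        exact (eLpNorm_sub_le (hζcmem i _).1 (hζcmem i _).1 h1q).trans
          (add_le_add (hζnorm i (n + 1) _ (by omega)) (hζnorm i n _ (by omega)))
      · have hc : ∀ l, i < l → P[ζ i | ℱ l] = ζ i := fun l hl =>
          condExp_of_stronglyMeasurable (ℱ.le l) ((hζm i).mono (ℱ.mono hl))
            ((hζ i).integrable h1q)
        rw [hc _ (by omega), hc _ (by omega), sub_self]
        simp
    refine (Finset.sum_le_sum fun i _ => hterm i).trans ?_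
    rw [← ENNReal.ofReal_sum_of_nonneg fun i _ => by
      split_ifs
      · exact (add_pos (hb0 _) (hb0 _)).le
      · exact le_rfl]
    refine ENNReal.ofReal_le_ofReal ?_
    rw [← Finset.sum_filter, Finset.sum_add_distrib, two_mul]
    refine add_le_add (hb.sum_comp_le_tsum_of_injOn (fun k => (hb0 k).le) ?_)
      (hb.sum_comp_le_tsum_of_injOn (fun k => (hb0 k).le) ?_)
    all_goals
      intro x hx y hy hxy
      simp only [Finset.coe_filter, Finset.mem_range, Set.mem_ofPred_eq] at hx hy hxy
      omega
  have h0 : P[S | ℱ 0] =ᵐ[P] 0 := by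
    rw [hℱ0, condExp_bot]
    have : ∫ ω, S ω ∂P = 0 := by
      simp only [hS, Finset.sum_apply]
      rw [integral_finsetSum _ fun i _ => (hζ i).integrable h1q]
      simp [hζ0]
    rw [this]; rfl
  have hp : P[S | ℱ p] = S := by
    refine condExp_of_stronglyMeasurable (ℱ.le p) ?_ hSint
    refine Finset.stronglyMeasurable_sum _ fun i hi => ?_
    exact (hζm i).mono (ℱ.mono (Finset.mem_range.1 hi))
  have := (hA P ℱ (fun n => P[S | ℱ n]) (2 * T) (by positivity) (martingale_condExp S ℱ P) h0
    (fun n => (hcmem (n + 1)).sub (hcmem n)) hinc p).2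
  simp only [hp] at this
  simpa [hS] using this

/-- Moments of partial sums of a `φ`-mixing sequence of centred variables. -/
theorem exists_integral_abs_sum_rpow_le_of_phiMixingCoeff_le {q : ℝ} (hq : 2 ≤ q) {φ : ℕ → ℝ}
    (hφ : Summable fun k : ℕ => √(φ (k + 1))) (L : ℝ) :
    ∃ R : ℝ, 0 < R ∧ ∀ {Ω : Type w} {_ : MeasurableSpace Ω} (P : Measure Ω)
      [IsProbabilityMeasure P] {E : Type} [MeasurableSpace E] (ξ : ℕ → Ω → E)
      (ζ : ℕ → Ω → ℝ), (∀ i, Measurable (ξ i)) →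
      (∀ k, 1 ≤ k → phiMixingCoeff P ξ k ≤ φ k) →
      (∀ i, Measurable[MeasurableSpace.comap (ξ i) inferInstance] (ζ i)) →
      (∀ i, MemLp (ζ i) (ENNReal.ofReal q) P) →
      (∀ i, ∫ ω, ζ i ω ∂P = 0) → (∀ i, ∫ ω, |ζ i ω| ^ q ∂P ≤ L) →
      ∀ p : ℕ, ∫ ω, |∑ i ∈ Finset.range p, ζ i ω| ^ q ∂P ≤ (R * √p) ^ q := by
  have hq0 : 0 < q := by linarith
  have h1q : (1 : ℝ≥0∞) ≤ ENNReal.ofReal q := by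
    rw [← ENNReal.ofReal_one]; exact ENNReal.ofReal_le_ofReal (by linarith)
  set K := max L 1 with hK
  have hK1 : 1 ≤ K := le_max_right _ _
  have hK0 : 0 < K := by linarith
  -- The geometric term keeps `b` positive and strictly above `√φ`, even where `φ` vanishes.
  set b : ℕ → ℝ := fun k => 2 * K * (√(φ k) + (1 / 2) ^ k) with hbdef
  have hb : Summable b := by
    rw [← summable_nat_add_iff 1]
    refine (hφ.add ?_).mul_left _
    exact (summable_nat_add_iff 1).2 summable_geometric_two
  have hb0 : ∀ k, 0 < b k := fun k => by positivity
  obtain ⟨R, hR, h⟩ := exists_integral_abs_sum_rpow_le_of_condExp.{w} hq hb hb0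
  refine ⟨R, hR, fun {Ω} {_} P _ {E} _ ξ ζ hξ hmix hζm hζ hζ0 hζL => ?_⟩
  have hsm : ∀ i, StronglyMeasurable[strictPast ξ hξ (i + 1)] (ζ i) := fun i =>
    ((hζm i).mono (comap_le_strictPast hξ i.lt_succ_self) le_rfl).stronglyMeasurable
  refine h P (strictPast ξ hξ) ζ (strictPast_zero hξ) hsm hζ hζ0 fun n k => ?_
  rcases Nat.eq_zero_or_pos k with rfl | hk
  -- Lag `0` involves no mixing: conditional expectation contracts `L^q`, and `b 0 ≥ K` suffices.
  · have hb0K : K ≤ b 0 := by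
      simp only [hbdef, pow_zero]
      nlinarith [Real.sqrt_nonneg (φ 0)]
    refine (eLpNorm_le_ofReal_iff_integral_abs_rpow_le hq0 (hb0 0).le
      ((hζ _).condExp h1q)).1 ((eLpNorm_condExp_le_eLpNorm _ h1q).trans ?_)
    refine (eLpNorm_le_ofReal_iff_integral_abs_rpow_le hq0 (hb0 0).le (hζ _)).2 ?_
    calc _ ≤ K := (hζL _).trans (le_max_left _ _)
      _ ≤ K ^ q := Real.self_le_rpow_of_one_le hK1 (by linarith)
      _ ≤ b 0 ^ q := by gcongr
  · refine integral_abs_condExp_strictPast_rpow_le hξ hq hK1 hk (by positivity) ?_ (hζm _)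
      (hζ _) (hζ0 _) ((hζL _).trans (le_max_left _ _))
    have h1 := hmix k hk
    have h2 : 0 ≤ φ k := (phiMixingCoeff_nonneg k).trans h1
    have h3 := Real.sq_sqrt h2
    have h4 : (0 : ℝ) < (1 / 2) ^ k := by positivity
    nlinarith [Real.sqrt_nonneg (φ k)]

/-! ### Concentration of inner products. -/

theorem MeasureTheory.integrable_abs_rpow_of_lintegral_le {Ω : Type*} [MeasurableSpace Ω]
    {P : Measure Ω} {r : ℝ} (hr : 0 < r) {f : Ω → ℝ} (hf : Measurable f) {K : ℝ≥0}
    (h : ∫⁻ ω, ‖f ω‖ₑ ^ r ∂P ≤ K) :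
    Integrable (fun ω => |f ω| ^ r) P ∧ ∫ ω, |f ω| ^ r ∂P ≤ K := by
  have e : ∀ ω, ENNReal.ofReal (|f ω| ^ r) = ‖f ω‖ₑ ^ r := fun ω => by
    rw [Real.enorm_eq_ofReal_abs, ENNReal.ofReal_rpow_of_nonneg (abs_nonneg _) hr.le]
  have h0 : ∀ ω, 0 ≤ |f ω| ^ r := fun ω => by positivity
  have hm : Measurable fun ω => |f ω| ^ r := by fun_prop
  constructor
  · refine ⟨hm.aestronglyMeasurable, ?_⟩
    rw [hasFiniteIntegral_iff_ofReal (ae_of_all _ h0)]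
    simp only [e]
    exact h.trans_lt ENNReal.coe_lt_top
  · rw [integral_eq_lintegral_of_nonneg_ae (ae_of_all _ h0) hm.aestronglyMeasurable]
    simp only [e]
    exact ENNReal.toReal_le_coe_of_le_coe h

theorem Real.abs_le_one_add_abs_rpow {q : ℝ} (hq : 1 ≤ q) (x : ℝ) : |x| ≤ 1 + |x| ^ q := by
  rcases le_total |x| 1 with h | h
  · linarith [Real.rpow_nonneg (abs_nonneg x) q]
  · linarith [Real.self_le_rpow_of_one_le h hq]

/-- Tail bound for the centred inner product of two jointly `φ`-mixing sequences. -/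
theorem exists_real_lt_abs_sum_mul_sub_integral_le {q : ℝ} (hq : 2 ≤ q) {φ : ℕ → ℝ}
    (hφ : Summable fun k : ℕ => √(φ (k + 1))) (K : ℝ≥0) :
    ∃ R : ℝ, 0 < R ∧ ∀ {Ω : Type w} {mΩ : MeasurableSpace Ω} (P : Measure Ω)
      [IsProbabilityMeasure P] (U V : ℕ → Ω → ℝ), (∀ j, Measurable (U j)) →
      (∀ j, Measurable (V j)) →
      (∀ k, 1 ≤ k → phiMixingCoeff P (fun j ω => (U j ω, V j ω)) k ≤ φ k) →
      (∀ j, ∫⁻ ω, ‖U j ω‖ₑ ^ (2 * q) ∂P ≤ K) → (∀ j, ∫⁻ ω, ‖V j ω‖ₑ ^ (2 * q) ∂P ≤ K) →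
      (∀ j, Integrable (fun ω => U j ω * V j ω) P) ∧ ∀ (p : ℕ) (t : ℝ), 0 < t →
        P.real {ω | t < |∑ j ∈ Finset.range p, (U j ω * V j ω - ∫ ω, U j ω * V j ω ∂P)|} ≤
          (R * √p / t) ^ q := by
  have hq0 : 0 < q := by linarith
  have h1q : (1 : ℝ≥0∞) ≤ ENNReal.ofReal q := by
    rw [← ENNReal.ofReal_one]; exact ENNReal.ofReal_le_ofReal (by linarith)
  -- `2 * K` bounds the `q`-th moment of a product `U j * V j`, `1 + 2 * K` bounds its mean, and `2
  -- ^ q` is the cost of centring.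
  set L : ℝ := 2 ^ q * (2 * K + (1 + 2 * K) ^ q) with hL
  obtain ⟨R, hR, h⟩ := exists_integral_abs_sum_rpow_le_of_phiMixingCoeff_le.{w} hq hφ L
  refine ⟨R, hR, fun {Ω} {_} P _ U V hU hV hmix hUK hVK => ?_⟩
  have hU2 := fun j => integrable_abs_rpow_of_lintegral_le (by linarith) (hU j) (hUK j)
  have hV2 := fun j => integrable_abs_rpow_of_lintegral_le (by linarith) (hV j) (hVK j)
  have hpt : ∀ j ω, |U j ω * V j ω| ^ q ≤ |U j ω| ^ (2 * q) + |V j ω| ^ (2 * q) := fun j ω => by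
    have := Real.rpow_sub_mul_rpow_le (q := 2 * q) hq0.le (by linarith) (abs_nonneg (U j ω))
      (abs_nonneg (V j ω))
    rwa [show 2 * q - q = q by ring, ← Real.mul_rpow (abs_nonneg _) (abs_nonneg _),
      ← abs_mul] at this
  have hUVm : ∀ j, Measurable fun ω => U j ω * V j ω := fun j => (hU j).mul (hV j)
  have hUVq : ∀ j, Integrable (fun ω => |U j ω * V j ω| ^ q) P := fun j => by
    refine ((hU2 j).1.add (hV2 j).1).mono' ((hUVm j).abs.pow_const q).aestronglyMeasurable
      (ae_of_all _ fun ω => ?_)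
    rw [Real.norm_of_nonneg (by positivity)]
    exact hpt j ω
  have hUVle : ∀ j, ∫ ω, |U j ω * V j ω| ^ q ∂P ≤ 2 * K := fun j => by
    refine (integral_mono (hUVq j) ((hU2 j).1.add (hV2 j).1) (hpt j)).trans ?_
    rw [integral_add' (hU2 j).1 (hV2 j).1]
    linarith [(hU2 j).2, (hV2 j).2]
  have hmem : ∀ j, MemLp (fun ω => U j ω * V j ω) (ENNReal.ofReal q) P := fun j =>
    memLp_of_integrable_abs_rpow hq0 (hUVm j).aestronglyMeasurable (hUVq j)
  have hint : ∀ j, Integrable (fun ω => U j ω * V j ω) P := fun j => (hmem j).integrable h1q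
  refine ⟨hint, fun p t ht => ?_⟩
  set c : ℕ → ℝ := fun j => ∫ ω, U j ω * V j ω ∂P with hc
  have hcle : ∀ j, |c j| ≤ 1 + 2 * K := fun j => by
    calc |c j| ≤ ∫ ω, |U j ω * V j ω| ∂P := abs_integral_le_integral_abs
      _ ≤ ∫ ω, (1 + |U j ω * V j ω| ^ q) ∂P :=
        integral_mono (hint j).abs ((integrable_const _).add (hUVq j))
          fun ω => Real.abs_le_one_add_abs_rpow (by linarith) _
      _ ≤ 1 + 2 * K := by
        rw [integral_add (integrable_const _) (hUVq j)]
        simpa using hUVle j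
  set ζ : ℕ → Ω → ℝ := fun j ω => U j ω * V j ω - c j with hζ
  have hζmem : ∀ j, MemLp (ζ j) (ENNReal.ofReal q) P := fun j => (hmem j).sub (memLp_const _)
  have hζL : ∀ j, ∫ ω, |ζ j ω| ^ q ∂P ≤ L := fun j => by
    have hle : ∀ ω, |ζ j ω| ^ q ≤ 2 ^ q * (|U j ω * V j ω| ^ q + (1 + 2 * K) ^ q) := fun ω => by
      have h1 := Real.abs_add_rpow_le (q := q) (by linarith) (U j ω * V j ω) (-c j)
      rw [abs_neg, ← sub_eq_add_neg] at h1
      refine h1.trans ?_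
      gcongr
      exact hcle j
    refine (integral_mono ((hζmem j).integrable_abs_rpow hq0)
      (((hUVq j).add (integrable_const _)).const_mul _) hle).trans ?_
    rw [integral_const_mul]
    refine mul_le_mul_of_nonneg_left ?_ (by positivity)
    change ∫ ω, (|U j ω * V j ω| ^ q + (1 + 2 * (K : ℝ)) ^ q) ∂P ≤ _
    rw [integral_add (hUVq j) (integrable_const _)]
    simpa using hUVle j
  have hmom := h P (fun j ω => (U j ω, V j ω)) ζ (fun j => (hU j).prodMk (hV j)) hmix
    (fun j => Measurable.comp (g := fun z : ℝ × ℝ => z.1 * z.2 - c j) (by fun_prop)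
      (comap_measurable _))
    hζmem (fun j => by
      simp only [hζ]
      rw [integral_sub (hint j) (integrable_const _)]
      simp [hc]) hζL p
  have hSmem : MemLp (fun ω => ∑ j ∈ Finset.range p, ζ j ω) (ENNReal.ofReal q) P :=
    memLp_finsetSum _ fun j _ => hζmem j
  have hmarkov := mul_meas_ge_le_integral_of_nonneg
    (f := fun ω => |∑ j ∈ Finset.range p, ζ j ω| ^ q) (μ := P)
    (ae_of_all _ fun ω => by positivity) (hSmem.integrable_abs_rpow hq0) (t ^ q)
  have htq : 0 < t ^ q := Real.rpow_pos_of_pos ht q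
  rw [Real.div_rpow (by positivity) ht.le, le_div_iff₀ htq, mul_comm]
  refine le_trans ?_ (hmarkov.trans hmom)
  refine mul_le_mul_of_nonneg_left (measureReal_mono fun ω hω => ?_) htq.le
  exact Real.rpow_le_rpow ht.le (le_of_lt hω) hq0.le

/-! ### From inner products to cosines. -/

/-- The cosine of the angle between two vectors is close to any number that is close to their
normalised inner product, provided that the vectors have nearly unit normalised length. -/
theorem abs_sub_inner_div_norm_mul_norm_le {F : Type*} [NormedAddCommGroup F]
    [InnerProductSpace ℝ F] {x y : F} {r α t : ℝ} (hr : 0 < r) (hxy : |r⁻¹ * ⟪x, y⟫ - α| ≤ t)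
    (hx : |r⁻¹ * ⟪x, x⟫ - 1| ≤ t) (hy : |r⁻¹ * ⟪y, y⟫ - 1| ≤ t) :
    |α - ⟪x, y⟫ / (‖x‖ * ‖y‖)| ≤ 2 * t := by
  have ht : 0 ≤ t := (abs_nonneg _).trans hxy
  rw [real_inner_self_eq_norm_sq] at hx hy
  set N := ‖x‖ * ‖y‖ with hN
  have hN0 : 0 ≤ N := by positivity
  set s := r⁻¹ * N with hs
  have hs0 : 0 ≤ s := by positivity
  have hs2 : s ^ 2 = (r⁻¹ * ‖x‖ ^ 2) * (r⁻¹ * ‖y‖ ^ 2) := by rw [hs, hN]; ring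
  set a := r⁻¹ * ‖x‖ ^ 2
  set b := r⁻¹ * ‖y‖ ^ 2
  have ha0 : 0 ≤ a := by positivity
  have hb0 : 0 ≤ b := by positivity
  rw [abs_le] at hx hy
  -- `s` is the geometric mean of `a` and `b`, both in `[1 - t, 1 + t]`. If `t ≥ 1` the lower bound
  -- is just `s ≥ 0`.
  have hs1 : |s - 1| ≤ t := by
    rw [abs_le]
    constructor
    · rcases le_total (1 - t) 0 with h | h
      · linarith
      · have : (1 - t) ^ 2 ≤ s ^ 2 := by
          rw [hs2, sq]
          exact mul_le_mul (by linarith) (by linarith) h ha0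
        linarith [le_of_sq_le_sq this hs0]
    · have : s ^ 2 ≤ (1 + t) ^ 2 := by
        rw [hs2, sq]
        exact mul_le_mul (by linarith) (by linarith) hb0 (by linarith)
      linarith [le_of_sq_le_sq this (by linarith)]
  have hcos : |⟪x, y⟫ / N| ≤ 1 := abs_real_inner_div_norm_mul_norm_le_one x y
  -- The normalised inner product is the cosine times `s`, also for `N = 0`, where both sides
  -- vanish. As the cosine is at most `1` in absolute value, replacing `s` by `1` costs at most `t`.
  have hinner : r⁻¹ * ⟪x, y⟫ = ⟪x, y⟫ / N * s := by
    rcases eq_or_ne N 0 with h0 | h0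
    · have h1 : ⟪x, y⟫ = 0 := by
        have := abs_real_inner_le_norm x y
        rw [← hN, h0] at this
        exact abs_nonpos_iff.1 this
      simp [h1]
    · rw [hs]; field_simp
  have h2 : |⟪x, y⟫ / N * (s - 1)| ≤ t := by
    rw [abs_mul]
    calc _ ≤ 1 * t := by gcongr
      _ = t := one_mul t
  calc |α - ⟪x, y⟫ / N| = |-(r⁻¹ * ⟪x, y⟫ - α) + ⟪x, y⟫ / N * (s - 1)| := by
        rw [hinner]; congr 1; ring
    _ ≤ |r⁻¹ * ⟪x, y⟫ - α| + |⟪x, y⟫ / N * (s - 1)| := by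
        rw [← abs_neg (r⁻¹ * ⟪x, y⟫ - α)]; exact abs_add_le _ _
    _ ≤ 2 * t := by linarith

theorem inner_firstCoords {Ω : Type*} (p : ℕ) (ξ η : ℕ → Ω → ℝ) (ω : Ω) :
    ⟪firstCoords p ξ ω, firstCoords p η ω⟫ = ∑ j ∈ Finset.range p, ξ j ω * η j ω := by
  simp [firstCoords, PiLp.inner_apply, Finset.sum_range, mul_comm]

namespace MultiplicativeModel

variable {n p : ℕ} (M : MultiplicativeModel.{u, w} n p)

theorem cosSim_eq_of_pos {i j : Fin n} {ω : M.Ω} (hi : 0 < M.γ i ω) (hj : 0 < M.γ j ω) :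
    M.cosSim i j ω = ⟪M.Xvec (M.leaf i).1 ω, M.Xvec (M.leaf j).1 ω⟫ /
      (‖M.Xvec (M.leaf i).1 ω‖ * ‖M.Xvec (M.leaf j).1 ω‖) := by
  simp only [cosSim, Y, norm_smul, real_inner_smul_left, real_inner_smul_right,
    Real.norm_of_nonneg hi.le, Real.norm_of_nonneg hj.le]
  rw [← mul_div_mul_left ⟪M.Xvec (M.leaf i).1 ω, M.Xvec (M.leaf j).1 ω⟫
    (‖M.Xvec (M.leaf i).1 ω‖ * ‖M.Xvec (M.leaf j).1 ω‖) (mul_pos hi hj).ne']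
  congr 1 <;> ring

theorem affinity_self {v : M.V} (hv : M.tree.IsLeaf v) : M.affinity v v = 1 := by
  simp only [affinity, real_inner_self_eq_norm_sq]
  exact M.normalised v hv

theorem inv_mul_inner_sub_affinity {a b : M.V}
    (h : ∀ j, Integrable (fun ω => M.X a j ω * M.X b j ω) M.P) (ω : M.Ω) :
    (p : ℝ)⁻¹ * ⟪M.Xvec a ω, M.Xvec b ω⟫ - M.affinity a b =
      (p : ℝ)⁻¹ * ∑ j ∈ Finset.range p,
        (M.X a j ω * M.X b j ω - ∫ ω, M.X a j ω * M.X b j ω ∂M.P) := by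
  simp only [affinity, Xvec, inner_firstCoords]
  rw [integral_finsetSum _ fun j _ => h j, Finset.sum_sub_distrib]
  ring

/-- If all normalised inner products are within `t` of their means, the maximal error of the
cosine similarities is at most `2 t`. -/
theorem abs_maxError_le {ω : M.Ω} (hγ : ∀ i, 0 < M.γ i ω) (hp : 0 < p) {t : ℝ} (ht : 0 ≤ t)
    (h : ∀ i j, |(p : ℝ)⁻¹ * ⟪M.Xvec (M.leaf i).1 ω, M.Xvec (M.leaf j).1 ω⟫ -
      M.affinity (M.leaf i).1 (M.leaf j).1| ≤ t) : |M.maxError ω| ≤ 2 * t := by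
  rw [maxError, abs_of_nonneg (Real.iSup_nonneg fun e => abs_nonneg _)]
  refine Real.iSup_le (fun e => ?_) (by positivity)
  rw [M.cosSim_eq_of_pos (hγ _) (hγ _)]
  have hself : ∀ i, |(p : ℝ)⁻¹ * ⟪M.Xvec (M.leaf i).1 ω, M.Xvec (M.leaf i).1 ω⟫ - 1| ≤ t :=
    fun i => by simpa only [M.affinity_self (M.leaf i).2] using h i i
  exact abs_sub_inner_div_norm_mul_norm_le (by exact_mod_cast hp) (h _ _) (hself _) (hself _)

end MultiplicativeModel

/-! ### Union bound over pairs of leaves. -/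

/-- The cosine similarities of the data converge to the affinities at rate `n ^ (2 / q) / √p`, in
any family of multiplicative noise models, one for every sample size `n ≥ 1` and every dimension
`p ≥ 1`, with common mixing rates `φ` and a common bound on the moments of order `2 q`. -/
theorem theorem3 (M : ∀ n p : ℕ+, MultiplicativeModel.{u, w} n p)
    (φ : ℕ → ℝ) (hφ : Summable (fun k : ℕ => √(φ (k + 1))))
    (hmix : ∀ (n p : ℕ+) (a b : (M n p).V), (M n p).tree.IsLeaf a → (M n p).tree.IsLeaf b →
      ∀ k : ℕ, 1 ≤ k →
        phiMixingCoeff (M n p).P (fun j ω => ((M n p).X a j ω, (M n p).X b j ω)) k ≤ φ k)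
    (q : ℝ) (hq : 2 ≤ q)
    (hmom : ∃ K : ℝ≥0, ∀ (n p : ℕ+) (v : (M n p).V), (M n p).tree.IsLeaf v → ∀ j : ℕ,
      ∫⁻ ω, ‖(M n p).X v j ω‖ₑ ^ (2 * q) ∂(M n p).P ≤ K) :
    IsBigOInProbability (ι := ℕ+ × ℕ+) (fun i => (M i.1 i.2).P) (fun i => (M i.1 i.2).maxError)
      (fun i => ((i.1 : ℕ) : ℝ) ^ (2 / q) / √((i.2 : ℕ) : ℝ)) := by
  obtain ⟨K, hK⟩ := hmom
  have hq0 : 0 < q := by linarith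
  obtain ⟨R, hR, htail⟩ := exists_real_lt_abs_sum_mul_sub_integral_le.{w} hq hφ K
  intro ε hε
  -- Chosen so that the tail bound at `p * t` is `(s / n ^ (2 / q)) ^ q = ε / (2n²)`. The `2` in `δ
  -- = 2R/s` is the loss in passing to cosines.
  set s : ℝ := (ε / 2) ^ q⁻¹ with hs
  have hs0 : 0 < s := by positivity
  have hsq : s ^ q = ε / 2 := Real.rpow_inv_rpow (by positivity) hq0.ne'
  refine ⟨2 * (R / s), by positivity, ?_⟩
  rintro ⟨n, p⟩
  set N := M n p
  have hn : (0 : ℝ) < (n : ℕ) := by exact_mod_cast n.pos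
  have hp : (0 : ℝ) < (p : ℕ) := by exact_mod_cast p.pos
  have hsp : 0 < √((p : ℕ) : ℝ) := Real.sqrt_pos.2 hp
  have hnq : 0 < ((n : ℕ) : ℝ) ^ (2 / q) := Real.rpow_pos_of_pos hn _
  set t : ℝ := R / s * (((n : ℕ) : ℝ) ^ (2 / q) / √((p : ℕ) : ℝ)) with ht
  have ht0 : 0 < t := by positivity
  -- Diagonal pairs are included because they control the norms.
  let bad : Fin n × Fin n → Set N.Ω := fun e =>
    {ω | t < |((p : ℕ) : ℝ)⁻¹ * ⟪N.Xvec (N.leaf e.1).1 ω, N.Xvec (N.leaf e.2).1 ω⟫ -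
      N.affinity (N.leaf e.1).1 (N.leaf e.2).1|}
  have hbad : ∀ e, N.P.real (bad e) ≤ ε / 2 / ((n : ℕ) : ℝ) ^ 2 := fun e => by
    obtain ⟨hint, hP⟩ := htail N.P (N.X (N.leaf e.1).1) (N.X (N.leaf e.2).1)
      (N.measurable_X _) (N.measurable_X _)
      (hmix n p _ _ (N.leaf e.1).2 (N.leaf e.2).2)
      (hK n p _ (N.leaf e.1).2) (hK n p _ (N.leaf e.2).2)
    have hset : bad e ⊆ {ω | p * t < |∑ j ∈ Finset.range p,
        (N.X (N.leaf e.1).1 j ω * N.X (N.leaf e.2).1 j ω -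
          ∫ ω, N.X (N.leaf e.1).1 j ω * N.X (N.leaf e.2).1 j ω ∂N.P)|} := fun ω hω => by
      have h1 : t < _ := hω
      rw [N.inv_mul_inner_sub_affinity hint, abs_mul, abs_of_pos (inv_pos.2 hp),
        lt_inv_mul_iff₀ hp] at h1
      exact h1
    refine (measureReal_mono hset).trans ((hP p (p * t) (by positivity)).trans (le_of_eq ?_))
    have e1 : R * √((p : ℕ) : ℝ) / (p * t) = s / ((n : ℕ) : ℝ) ^ (2 / q) := by
      have h2 : ((p : ℕ) : ℝ) = √((p : ℕ) : ℝ) * √((p : ℕ) : ℝ) := (Real.mul_self_sqrt hp.le).symm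
      rw [ht, div_eq_div_iff (by positivity) hnq.ne']
      nth_rewrite 2 [h2]
      field_simp
    rw [e1, Real.div_rpow hs0.le hnq.le, hsq, ← Real.rpow_mul hn.le, div_mul_cancel₀ _ hq0.ne',
      Real.rpow_two]
  have hγ : ∀ᵐ ω ∂N.P, ∀ i, 0 < N.γ i ω := ae_all_iff.2 N.γ_pos
  have hsub : ({ω | 2 * (R / s) * (((n : ℕ) : ℝ) ^ (2 / q) / √((p : ℕ) : ℝ)) < |N.maxError ω|} :
      Set N.Ω) ≤ᵐ[N.P] (⋃ e, bad e : Set N.Ω) := by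
    filter_upwards [hγ] with ω hω hlt
    by_contra hnot
    have hnot' : ω ∉ ⋃ e, bad e := hnot
    simp only [Set.mem_iUnion, not_exists] at hnot'
    have hle := N.abs_maxError_le hω p.pos ht0.le fun i j => not_lt.1 (hnot' (i, j))
    have hlt' : 2 * (R / s) * (((n : ℕ) : ℝ) ^ (2 / q) / √((p : ℕ) : ℝ)) < |N.maxError ω| := hlt
    rw [mul_assoc, ← ht] at hlt'
    linarith
  calc _ ≤ N.P.real (⋃ e, bad e) :=
        ENNReal.toReal_mono (measure_ne_top _ _) (measure_mono_ae hsub)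
    _ ≤ ∑ e, N.P.real (bad e) := measureReal_iUnion_fintype_le _
    _ ≤ ∑ _e : Fin n × Fin n, ε / 2 / ((n : ℕ) : ℝ) ^ 2 := Finset.sum_le_sum fun e _ => hbad e
    _ = ε / 2 := by
        simp only [Finset.sum_const, Finset.card_univ, Fintype.card_prod, Fintype.card_fin,
          nsmul_eq_mul, Nat.cast_mul]
        field_simp
    _ < ε := by linarith
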